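/- Let $n\in\mathbb N$, $T>0$, let $\rho_0,\theta\in\mathbb C^{n\times n}$ be Hermitian and let $H_1\in\mathfrak{su}(n)$ (traceless skew-Hermitian matrices). Let $\mathcal H=L^2([0,T],\mathbb R)$ with $(u,v)_{\mathcal H}=\int_0^T uv\,dt$. For $H_0\in\mathfrak{su}(n)$ and $u\in\mathcal H$, let $\rho$ be the (Carathéodory) solution on $[0,T]$ of $$\dot\rho(t)=[H_0+u(t)H_1,\rho(t)],\qquad \rho(0)=\rho_0,$$ and put $\mathrm{End}(u):=\rho(T)$, a point of the orbit $\mathcal O(\rho_0)=\{U\rho_0U^\dagger: U\in SU(n)\}$. Equip $T_\rho\mathcal O(\rho_0)=\{[\rho,\Omega]:\Omega\in\mathfrak{su}(n)\}$ with the metric $\langle[\rho,\Omega_1],[\rho,\Omega_2]\rangle_\rho=\mathrm{tr}\big((\Omega_1^{\mathfrak p})^\dagger\Omega_2^{\mathfrak p}\big)$, where $\Omega^{\mathfrak p}$ is the component of $\Omega$ orthogonal, for the product $\mathrm{tr}(A^\dagger B)$ on $\mathfrak{su}(n)$, to $\{\Omega\in\mathfrak{su}(n):[\rho,\Omega]=0\}$.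 Let $\nabla J$ be the gradient of $J(\rho)=\mathrm{Re}\,\mathrm{tr}(\rho\theta)$ on $\mathcal O(\rho_0)$ for this metric, let $\mathcal J=J\circ\mathrm{End}$, and let $d\mathrm{End}^*(u):T_{\mathrm{End}(u)}\mathcal O(\rho_0)\to\mathcal H$ be the adjoint of the Fréchet differential $d\mathrm{End}(u)$, i.e. $\langle z,d\mathrm{End}(u)v\rangle_{\mathrm{End}(u)}=(d\mathrm{End}^*(u)z,v)_{\mathcal H}$. There is a constant $C$, depending only on $n,\rho_0,\theta,H_1,T$, such that for every $H_0\in\mathfrak{su}(n)$ the following hold. (a) For every $u\in\mathcal H$ these objects are well defined: the equation for $\rho$ has exactly one solution on $[0,T]$, $\mathrm{End}(u)\in\mathcal O(\rho_0)$, $\mathrm{End}$ is Fréchet differentiable at $u$ with $d\mathrm{End}(u)$ taking values in $T_{\mathrm{End}(u)}\mathcal O(\rho_0)$, and $d\mathrm{End}^*(u)$ and $\nabla J(\mathrm{End}(u))$ exist and are unique. Moreover $\mathcal J$ is differentiable at $u$ with $\nabla\mathcal J(u)=d\mathrm{End}^*(u)\,\nabla J(\mathrm{End}(u))$, and $\|\nabla\mathcal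 J(u)\|_{\mathcal H}\le C$. (b) For every $u_0\in\mathcal H$ the initial value problem $$\frac{d\Pi}{ds}(s)=d\mathrm{End}^*(\Pi(s))\,\nabla J(\mathrm{End}(\Pi(s))),\qquad \Pi(0)=u_0,$$ has a solution $\Pi:[0,\infty)\to\mathcal H$ defined for all $s\ge0$, and it is unique: every solution on an interval $I\subseteq[0,\infty)$ containing $0$ coincides with $\Pi$ on $I$. -/

import Mathlib

open MeasureTheory Set
open scoped Matrix Matrix.Norms.Frobenius

noncomputable section

namespace QuantumControl

/-- The space `L²([0,T], ℝ)` of controls, with inner product `(u, v) = ∫₀ᵀ u v`. -/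
abbrev Control (T : ℝ) : Type := Lp ℝ 2 (volume.restrict (Icc (0 : ℝ) T))

/-- Complex `n × n` matrices, carrying the Frobenius (Hilbert-Schmidt) norm. -/
abbrev Mat (n : ℕ) : Type := Matrix (Fin n) (Fin n) ℂ

/-- The real vector space `𝔰𝔲(n)` of traceless skew-Hermitian matrices. -/
def su (n : ℕ) : Submodule ℝ (Mat n) where
  carrier := {A | Aᴴ = -A ∧ A.trace = 0}
  add_mem' := by
    rintro A B ⟨hA, hA'⟩ ⟨hB, hB'⟩
    refine ⟨?_, ?_⟩
    · rw [Matrix.conjTranspose_add, hA, hB, neg_add]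
    · rw [Matrix.trace_add, hA', hB', add_zero]
  zero_mem' := by simp
  smul_mem' := by
    rintro c A ⟨hA, hA'⟩
    refine ⟨?_, ?_⟩
    · rw [Matrix.conjTranspose_smul, hA, star_trivial, smul_neg]
    · rw [Matrix.trace_smul, hA', smul_zero]

/-- The orbit `𝒪(ρ₀) = {U ρ₀ U† : U ∈ SU(n)}`. -/
def unitaryOrbit {n : ℕ} (ρ₀ : Mat n) : Set (Mat n) :=
  {ρ | ∃ U ∈ Matrix.specialUnitaryGroup (Fin n) ℂ, ρ = U * ρ₀ * Uᴴ}

/-- `ad_ρ Ω = [ρ, Ω] = ρ Ω - Ω ρ`, as a real linear map. -/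
def adMap {n : ℕ} (ρ : Mat n) : Mat n →ₗ[ℝ] Mat n :=
  LinearMap.mulLeft ℝ ρ - LinearMap.mulRight ℝ ρ

/-- The tangent space `T_ρ 𝒪(ρ₀) = ad_ρ 𝔰𝔲(n)` of the orbit at its point `ρ`. -/
def tangentSpace {n : ℕ} (ρ : Mat n) : Submodule ℝ (Mat n) := (su n).map (adMap ρ)

/-- The Lie algebra `𝔥_ρ = {Ω ∈ 𝔰𝔲(n) : [ρ, Ω] = 0}` of the stabilizer of `ρ`. -/
def stabAlg {n : ℕ} (ρ : Mat n) : Submodule ℝ (Mat n) := su n ⊓ LinearMap.ker (adMap ρ)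

/-- `𝔭_ρ`: the orthogonal complement of `𝔥_ρ` in `𝔰𝔲(n)` for the Hilbert-Schmidt product
`tr (Ω₁† Ω₂)`.  If `ρ = U ρ₀ U†` with `U ∈ SU(n)`, this is `Ad_U 𝔭_{ρ₀}`
(see `horizontal_conj`). -/
def horizontal {n : ℕ} (ρ : Mat n) : Set (Mat n) :=
  {Ω | Ω ∈ su n ∧ ∀ Ω' ∈ stabAlg ρ, (Ωᴴ * Ω').trace = 0}

/-- `Ad_U` maps `𝔭_ρ` into `𝔭_{Ad_U ρ}`. -/
theorem horizontal_conj_mem {n : ℕ} (ρ U : Mat n)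
    (hU : U ∈ Matrix.specialUnitaryGroup (Fin n) ℂ) {Ω : Mat n} (hΩ : Ω ∈ horizontal ρ) :
    U * Ω * Uᴴ ∈ horizontal (U * ρ * Uᴴ) := by
  have h1 : Uᴴ * U = 1 := Matrix.mem_unitaryGroup_iff'.1 (Matrix.mem_specialUnitaryGroup_iff.1 hU).1
  have h2 : U * Uᴴ = 1 := Matrix.mem_unitaryGroup_iff.1 (Matrix.mem_specialUnitaryGroup_iff.1 hU).1
  obtain ⟨⟨hs, ht⟩, ho⟩ := hΩ
  refine ⟨⟨?_, ?_⟩, ?_⟩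
  · simp [Matrix.conjTranspose_mul, hs, Matrix.mul_assoc]
  · rw [Matrix.trace_mul_comm, ← Matrix.mul_assoc, h1, Matrix.one_mul, ht]
  · rintro Ω' ⟨⟨hs', ht'⟩, hk⟩
    have hk' : U * ρ * Uᴴ * Ω' = Ω' * (U * ρ * Uᴴ) := by
      have : U * ρ * Uᴴ * Ω' - Ω' * (U * ρ * Uᴴ) = 0 := hk
      exact sub_eq_zero.1 this
    have key : Uᴴ * Ω' * U ∈ stabAlg ρ := by
      refine ⟨⟨?_, ?_⟩, ?_⟩
      · simp [Matrix.conjTranspose_mul, hs', Matrix.mul_assoc]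
      · rw [Matrix.trace_mul_comm, ← Matrix.mul_assoc, h2, Matrix.one_mul, ht']
      · have e := congrArg (fun X => Uᴴ * X * U) hk'
        have e1 : Uᴴ * (U * ρ * Uᴴ * Ω') * U = (Uᴴ * U) * (ρ * (Uᴴ * Ω' * U)) := by
          simp only [Matrix.mul_assoc]
        have e2 : Uᴴ * (Ω' * (U * ρ * Uᴴ)) * U = (Uᴴ * Ω' * U * ρ) * (Uᴴ * U) := by
          simp only [Matrix.mul_assoc]
        have e3 : ρ * (Uᴴ * Ω' * U) = (Uᴴ * Ω' * U) * ρ := by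
          simpa only [e1, e2, h1, Matrix.one_mul, Matrix.mul_one] using e
        exact sub_eq_zero.2 e3
    have := ho _ key
    have e : (U * Ω * Uᴴ)ᴴ * Ω' = U * (Ωᴴ * (Uᴴ * Ω')) := by
      simp [Matrix.conjTranspose_mul, Matrix.mul_assoc]
    rw [e, Matrix.trace_mul_comm]
    simpa only [Matrix.mul_assoc] using this

/-- For `U ∈ SU(n)`, `𝔭_{Ad_U ρ} = Ad_U 𝔭_ρ`. -/
theorem horizontal_conj {n : ℕ} (ρ U : Mat n)
    (hU : U ∈ Matrix.specialUnitaryGroup (Fin n) ℂ) :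
    horizontal (U * ρ * Uᴴ) = (fun Ω => U * Ω * Uᴴ) '' horizontal ρ := by
  have h1 : Uᴴ * U = 1 := Matrix.mem_unitaryGroup_iff'.1 (Matrix.mem_specialUnitaryGroup_iff.1 hU).1
  have h2 : U * Uᴴ = 1 := Matrix.mem_unitaryGroup_iff.1 (Matrix.mem_specialUnitaryGroup_iff.1 hU).1
  have hU' : Uᴴ ∈ Matrix.specialUnitaryGroup (Fin n) ℂ := by
    rw [Matrix.mem_specialUnitaryGroup_iff] at hU ⊢
    refine ⟨Matrix.mem_unitaryGroup_iff.2 ?_, ?_⟩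
    · rw [Matrix.star_eq_conjTranspose, Matrix.conjTranspose_conjTranspose, h1]
    · rw [Matrix.det_conjTranspose, hU.2, star_one]
  have canc : ∀ X : Mat n, U * (Uᴴ * X * U) * Uᴴ = X := fun X => by
    calc U * (Uᴴ * X * U) * Uᴴ = (U * Uᴴ) * X * (U * Uᴴ) := by simp only [Matrix.mul_assoc]
      _ = X := by rw [h2, Matrix.one_mul, Matrix.mul_one]
  have canc' : ∀ X : Mat n, Uᴴ * (U * X * Uᴴ) * U = X := fun X => by
    calc Uᴴ * (U * X * Uᴴ) * U = (Uᴴ * U) * X * (Uᴴ * U) := by simp only [Matrix.mul_assoc]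
      _ = X := by rw [h1, Matrix.one_mul, Matrix.mul_one]
  ext Ω
  constructor
  · intro hΩ
    have := horizontal_conj_mem _ _ hU' hΩ
    rw [Matrix.conjTranspose_conjTranspose, canc'] at this
    exact ⟨_, this, canc Ω⟩
  · rintro ⟨Ω', h, rfl⟩
    exact horizontal_conj_mem _ _ hU h

/-- The real Hilbert-Schmidt form `(A, B) ↦ Re tr (A† B)`. -/
def hsForm (n : ℕ) : LinearMap.BilinForm ℝ (Mat n) :=
  LinearMap.mk₂ ℝ (fun A B => ((Aᴴ * B).trace).re)
    (by intro A A' B; simp [Matrix.add_mul])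
    (by intro c A B; simp [Matrix.conjTranspose_smul])
    (by intro A B B'; simp [Matrix.mul_add])
    (by intro c A B; simp)

/-- Every tangent vector at `ρ` is `[ρ, Ω]` for exactly one `Ω ∈ 𝔭_ρ`. -/
theorem existsUnique_lift {n : ℕ} (ρ ξ : Mat n) (hξ : ξ ∈ tangentSpace ρ) :
    ∃! Ω : Mat n, Ω ∈ horizontal ρ ∧ adMap ρ Ω = ξ := by
  have hpos : ∀ A : Mat n, ((Aᴴ * A).trace).re = 0 → A = 0 := by
    intro A hA
    open scoped ComplexOrder in
    rw [← Matrix.trace_conjTranspose_mul_self_eq_zero_iff]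
    apply Complex.ext hA
    have h : star ((Aᴴ * A).trace) = (Aᴴ * A).trace := by
      rw [← Matrix.trace_conjTranspose]; simp [Matrix.conjTranspose_mul]
    have h' := congrArg Complex.im h
    simp only [Complex.star_def, Complex.conj_im] at h'
    simp only [Complex.zero_im]
    linarith
  have hsymm : ∀ A B : Mat n, hsForm n A B = hsForm n B A := by
    intro A B
    have h : (Bᴴ * A).trace = star ((Aᴴ * B).trace) := by
      rw [← Matrix.trace_conjTranspose]; simp [Matrix.conjTranspose_mul]
    simp [hsForm, h]
  have hreal : ∀ A ∈ su n, ∀ B ∈ su n, ((Aᴴ * B).trace).im = 0 := by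
    rintro A ⟨hA, -⟩ B ⟨hB, -⟩
    have h : star ((Aᴴ * B).trace) = (Aᴴ * B).trace := by
      rw [← Matrix.trace_conjTranspose, Matrix.conjTranspose_mul,
        Matrix.conjTranspose_conjTranspose, hB, hA, Matrix.trace_mul_comm]
      simp
    have h' := congrArg Complex.im h
    simp only [Complex.star_def, Complex.conj_im] at h'
    linarith
  obtain ⟨Ω, hΩ, rfl⟩ := hξ
  have hcompl : IsCompl (stabAlg ρ) ((hsForm n).orthogonal (stabAlg ρ)) := by
    refine (LinearMap.BilinForm.isCompl_orthogonal_iff_disjoint (W := stabAlg ρ)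
      (fun A B h => by rw [hsymm]; exact h)).2 ?_
    rw [Submodule.disjoint_def]
    intro A hA hA'
    exact hpos A (hA' A hA)
  obtain ⟨a, ha, b, hb, hab⟩ : ∃ a ∈ stabAlg ρ, ∃ b ∈ (hsForm n).orthogonal (stabAlg ρ),
      a + b = Ω := by
    have : Ω ∈ stabAlg ρ ⊔ (hsForm n).orthogonal (stabAlg ρ) := by
      rw [hcompl.sup_eq_top]; trivial
    exact Submodule.mem_sup.1 this
  have hbsu : b ∈ su n := by
    have : b = Ω - a := by rw [← hab]; abel
    rw [this]
    exact (su n).sub_mem hΩ ha.1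
  refine ⟨b, ⟨⟨hbsu, fun Ω' h' => ?_⟩, ?_⟩, ?_⟩
  · refine Complex.ext ?_ (hreal b hbsu Ω' h'.1)
    have : hsForm n Ω' b = 0 := hb Ω' h'
    rw [hsymm] at this
    exact this
  · have h0 : adMap ρ a = 0 := ha.2
    rw [← hab, map_add, h0, zero_add]
  · rintro c ⟨⟨hc, hc'⟩, hc''⟩
    have hmem : c - b ∈ stabAlg ρ := by
      refine ⟨(su n).sub_mem hc hbsu, ?_⟩
      have h0 : adMap ρ a = 0 := ha.2
      change adMap ρ (c - b) = 0
      rw [map_sub, hc'', ← hab, map_add, h0, zero_add, sub_self]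
    refine sub_eq_zero.1 (hpos _ ?_)
    have e1 : ((cᴴ * (c - b)).trace).re = 0 := by rw [hc' _ hmem]; simp
    have e2 : ((bᴴ * (c - b)).trace).re = 0 := by
      have : hsForm n (c - b) b = 0 := hb _ hmem
      rw [hsymm] at this
      exact this
    rw [Matrix.conjTranspose_sub, Matrix.sub_mul, Matrix.trace_sub, Complex.sub_re, e1, e2, sub_zero]

open scoped Classical in
/-- The unique `Ω ∈ 𝔭_ρ` with `[ρ, Ω] = ξ`, for `ξ ∈ T_ρ 𝒪(ρ₀)` (and `0` for other `ξ`). -/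
def lift {n : ℕ} (ρ ξ : Mat n) : Mat n :=
  if h : ξ ∈ tangentSpace ρ then (existsUnique_lift ρ ξ h).choose else 0

/-- The Riemannian metric of the orbit:
`⟨ad_ρ Ω₁, ad_ρ Ω₂⟩_ρ = tr (Ω₁^𝔭† Ω₂^𝔭)`, where `Ω^𝔭` is the component of `Ω` in `𝔭_ρ`, i.e. the
element of `𝔭_ρ` with `ad_ρ Ω^𝔭 = ad_ρ Ω`.  The trace is real because `𝔭_ρ ⊆ 𝔰𝔲(n)`. -/
def metric {n : ℕ} (ρ ξ η : Mat n) : ℝ := (((lift ρ ξ)ᴴ * lift ρ η).trace).re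

/-- `ρ` solves `ρ' = [H₀ + u H₁, ρ]` on `[0,T]`, `ρ(0) = ρ₀`, in the sense of Carathéodory
(the right-hand side is only in `L²`): `ρ` is continuous and satisfies the integral equation. -/
def IsTrajectory {n : ℕ} {T : ℝ} (H₀ H₁ ρ₀ : Mat n) (u : Control T) (ρ : ℝ → Mat n) : Prop :=
  ContinuousOn ρ (Icc 0 T) ∧ ∀ t ∈ Icc 0 T,
    ρ t = ρ₀ + ∫ s in (0 : ℝ)..t,
      ((H₀ + u s • H₁) * ρ s - ρ s * (H₀ + u s • H₁))

open scoped Classical in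
/-- The end-point map `End_{ρ₀}(u) = ρ(T)`. -/
def endPoint {n : ℕ} {T : ℝ} (H₀ H₁ ρ₀ : Mat n) (u : Control T) : Mat n :=
  if h : ∃ ρ, IsTrajectory H₀ H₁ ρ₀ u ρ then h.choose T else 0

/-- The differential `d End_{ρ₀}(u)`. -/
def dEnd {n : ℕ} {T : ℝ} (H₀ H₁ ρ₀ : Mat n) (u : Control T) : Control T →L[ℝ] Mat n :=
  fderiv ℝ (fun w : Control T => endPoint H₀ H₁ ρ₀ w) u

/-- `A` is an adjoint of `d End_{ρ₀}(u)`: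
`⟨z, d End(u) v⟩_{End(u)} = (A z, v)` for all `z ∈ T_{End(u)} 𝒪(ρ₀)` and `v ∈ L²([0,T])`. -/
def IsAdjoint {n : ℕ} {T : ℝ} (H₀ H₁ ρ₀ : Mat n) (u : Control T)
    (A : tangentSpace (endPoint H₀ H₁ ρ₀ u) →ₗ[ℝ] Control T) : Prop :=
  ∀ (z : tangentSpace (endPoint H₀ H₁ ρ₀ u)) (v : Control T),
    metric (endPoint H₀ H₁ ρ₀ u) z (dEnd H₀ H₁ ρ₀ u v) = inner ℝ (A z) v

open scoped Classical in
/-- The adjoint operator `d End_{ρ₀}^*(u) : T_{End(u)} 𝒪(ρ₀) → L²([0,T])`. -/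
def dEndAdj {n : ℕ} {T : ℝ} (H₀ H₁ ρ₀ : Mat n) (u : Control T) :
    tangentSpace (endPoint H₀ H₁ ρ₀ u) →ₗ[ℝ] Control T :=
  if h : ∃ A, IsAdjoint H₀ H₁ ρ₀ u A then h.choose else 0

/-- The cost `J(ρ) = Re tr (ρ θ)`. -/
def costJ {n : ℕ} (θ ρ : Mat n) : ℝ := ((ρ * θ).trace).re

/-- `ζ` is a gradient of `J` at the point `ρ` of the orbit: `dJ(ρ) η = ⟨ζ, η⟩_ρ` for all tangent
vectors `η`.  The differential of `J` on the orbit is that of `J` on matrices, restricted to the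
tangent space. -/
def IsGradJ {n : ℕ} (θ ρ : Mat n) (ζ : tangentSpace ρ) : Prop :=
  ∀ η : tangentSpace ρ, fderiv ℝ (costJ θ) ρ (η : Mat n) = metric ρ ζ η

open scoped Classical in
/-- The Riemannian gradient `∇J(ρ) ∈ T_ρ 𝒪(ρ₀)`. -/
def gradJ {n : ℕ} (θ ρ : Mat n) : tangentSpace ρ :=
  if h : ∃ ζ, IsGradJ θ ρ ζ then h.choose else 0

/-- The right-hand side `d End_{ρ₀}^*(u) ∇J(End_{ρ₀}(u))` of the gradient flow. -/
def flowField {n : ℕ} {T : ℝ} (H₀ H₁ ρ₀ θ : Mat n) (u : Control T) : Control T :=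
  dEndAdj H₀ H₁ ρ₀ u (gradJ θ (endPoint H₀ H₁ ρ₀ u))

/-- `P` solves `dP/ds = d End^*(P) ∇J(End(P))`, `P(0) = u₀`, on the interval `I` (which contains
`0`); the derivative is that of the strong topology of `L²([0,T])`, one-sided at the ends of `I`. -/
def IsFlowSolution {n : ℕ} {T : ℝ} (H₀ H₁ ρ₀ θ : Mat n) (u₀ : Control T) (I : Set ℝ)
    (P : ℝ → Control T) : Prop :=
  P 0 = u₀ ∧ ∀ s ∈ I, HasDerivWithinAt P (flowField H₀ H₁ ρ₀ θ (P s)) I s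

end QuantumControl

end

open QuantumControl

/-! The field `flowField` is the gradient of `u ↦ J(End(u))`: the chain rule gives dJ(dEnd v) = ⟨∇J,
dEnd v⟩ = (dEnd* ∇J, v). So it suffices to show that this gradient is bounded on the whole of L²,
uniformly in the drift, and Lipschitz on bounded sets. A field with these two properties has unique
integral curves for all time (`exists_global_integralCurve`): bounded speed rules out blow-up, and a
Lipschitz constant on balls gives Picard–Lindelöf and Grönwall.

Regularity comes from writing the bilinear equation as x = x₀ + V_u x on C([0,T], E), with V_u a
Volterra operator that is affine in u. Conjugation by exp(lt), with l large, brings V_u below norm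
1/2, uniformly for u in a ball (`volterra_resolvent`). Hence x = (1 - V_u)⁻¹ x₀, and since the
derivative of an inverse R is R Q R, bounds on R over balls make the derivative Lipschitz there.
These bounds depend on the drift and grow with the ball.

The global bound comes instead from unitarity. Comparing the propagators of two controls in the
interaction picture cancels H₀ and gives V(T) - U(T) = U(T) ∫ (v - u) U* H₁ V dt, where all factors
except v - u are bounded independently of H₀, u and v. So ρ(T) = U(T) ρ₀ U(T)* is globally Lipschitz
in u, and the gradient of a Lipschitz function is bounded by its Lipschitz constant.

Identities that need classical derivatives are proved for continuous controls and extended by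
density, both sides being continuous in u (`control_induction`). -/

noncomputable section

namespace QuantumControl

open scoped NNReal

/-! ### Global integral curves of bounded, locally Lipschitz fields -/

section Flow

variable {X : Type*} [NormedAddCommGroup X] [NormedSpace ℝ X]

/-- Two integral curves of a vector field that is Lipschitz on bounded sets agree on `[0, b]` if
they start at the same point. -/
theorem eqOn_Icc_of_integralCurves {F : X → X}
    (hL : ∀ r : ℝ, ∃ K : ℝ≥0, LipschitzOnWith K F (Metric.closedBall 0 r)) {b : ℝ} {f g : ℝ → X}
    (hf : ∀ t ∈ Icc 0 b, HasDerivWithinAt f (F (f t)) (Icc 0 b) t)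
    (hg : ∀ t ∈ Icc 0 b, HasDerivWithinAt g (F (g t)) (Icc 0 b) t) (h0 : f 0 = g 0) :
    EqOn f g (Icc 0 b) := by
  have hfc : ContinuousOn f (Icc 0 b) := fun t ht => (hf t ht).continuousWithinAt
  have hgc : ContinuousOn g (Icc 0 b) := fun t ht => (hg t ht).continuousWithinAt
  -- Both curves have compact image, so a single ball, hence a single Lipschitz constant, serves for
  -- both.
  obtain ⟨r₁, h₁⟩ := (isCompact_Icc.image_of_continuousOn hfc).isBounded.subset_closedBall 0
  obtain ⟨r₂, h₂⟩ := (isCompact_Icc.image_of_continuousOn hgc).isBounded.subset_closedBall 0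
  obtain ⟨K, hK⟩ := hL (max r₁ r₂)
  have right : ∀ {h : ℝ → X}, (∀ t ∈ Icc 0 b, HasDerivWithinAt h (F (h t)) (Icc 0 b) t) →
      ∀ t ∈ Ico 0 b, HasDerivWithinAt h (F (h t)) (Ici t) t := by
    intro h hh t ht
    have := (hh t (Ico_subset_Icc_self ht)).mono (Icc_subset_Icc_left ht.1)
    exact this.mono_of_mem_nhdsWithin (Icc_mem_nhdsGE ht.2)
  exact ODE_solution_unique_of_mem_Icc_right (v := fun _ => F)
    (s := fun _ => Metric.closedBall 0 (max r₁ r₂)) (fun _ _ => hK) hfc (right hf)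
    (fun t ht => Metric.closedBall_subset_closedBall (le_max_left _ _)
      (h₁ (mem_image_of_mem f (Ico_subset_Icc_self ht)))) hgc (right hg)
    (fun t ht => Metric.closedBall_subset_closedBall (le_max_right _ _)
      (h₂ (mem_image_of_mem g (Ico_subset_Icc_self ht)))) h0

/-- A bounded vector field that is Lipschitz on bounded sets has integral curves on `[0, b]`. -/
theorem exists_integralCurve_Icc [CompleteSpace X] {F : X → X} {C : ℝ} (hC : ∀ x, ‖F x‖ ≤ C)
    (hL : ∀ r : ℝ, ∃ K : ℝ≥0, LipschitzOnWith K F (Metric.closedBall 0 r)) (x₀ : X) {b : ℝ}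
    (hb : 0 ≤ b) :
    ∃ P : ℝ → X, P 0 = x₀ ∧ ∀ t ∈ Icc 0 b, HasDerivWithinAt P (F (P t)) (Icc 0 b) t := by
  have hC0 : 0 ≤ C := (norm_nonneg _).trans (hC x₀)
  -- At speed at most C a curve moves at most C * b in time b. With this radius Picard–Lindelöf
  -- covers all of `[0, b]` at once, without continuation.
  set a : ℝ≥0 := ⟨C * b, mul_nonneg hC0 hb⟩
  obtain ⟨K, hK⟩ := hL (‖x₀‖ + C * b)
  have hsub : Metric.closedBall x₀ a ⊆ Metric.closedBall 0 (‖x₀‖ + C * b) := by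
    refine Metric.closedBall_subset_closedBall' ?_
    rw [dist_zero_right, add_comm]
    rfl
  have hPL : IsPicardLindelof (fun _ => F) (⟨0, le_rfl, hb⟩ : Icc (0 : ℝ) b) x₀ a 0
      ⟨C, hC0⟩ K := by
    refine IsPicardLindelof.of_time_independent (fun x _ => hC x) (hK.mono hsub) ?_
    simp only [sub_zero, sub_self, max_eq_left hb, NNReal.coe_zero]
    exact le_rfl
  exact hPL.exists_eq_forall_mem_Icc_hasDerivWithinAt₀

/-- A bounded vector field that is Lipschitz on bounded sets has a unique global forward
integral curve through every point. -/
theorem exists_global_integralCurve [CompleteSpace X] {F : X → X} {C : ℝ} (hC : ∀ x, ‖F x‖ ≤ C)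
    (hL : ∀ r : ℝ, ∃ K : ℝ≥0, LipschitzOnWith K F (Metric.closedBall 0 r)) (x₀ : X) :
    ∃ P : ℝ → X, (P 0 = x₀ ∧ ∀ s ∈ Ici (0 : ℝ), HasDerivWithinAt P (F (P s)) (Ici 0) s) ∧
      ∀ I : Set ℝ, I.OrdConnected → 0 ∈ I → I ⊆ Ici 0 → ∀ Q : ℝ → X,
        (Q 0 = x₀ ∧ ∀ s ∈ I, HasDerivWithinAt Q (F (Q s)) I s) → EqOn Q P I := by
  -- The solutions on `[0, N + 1]` are glued by using the one with N = ⌊s⌋ at s. The extra 1 puts s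
  -- strictly below the right end, so that the interval is a neighbourhood of s within `[0, ∞)`.
  have hex := fun N : ℕ => exists_integralCurve_Icc hC hL x₀ (b := (N : ℝ) + 1) (by positivity)
  choose G hG0 hG using hex
  have hGG : ∀ M N : ℕ, ∀ s : ℝ, 0 ≤ s → s ≤ M + 1 → s ≤ N + 1 → G M s = G N s := by
    intro M N s hs hM hN
    refine eqOn_Icc_of_integralCurves hL (b := s) (fun t ht => ?_) (fun t ht => ?_)
      ((hG0 M).trans (hG0 N).symm) ⟨hs, le_rfl⟩
    · exact (hG M t ⟨ht.1, ht.2.trans hM⟩).mono (Icc_subset_Icc_right hM)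
    · exact (hG N t ⟨ht.1, ht.2.trans hN⟩).mono (Icc_subset_Icc_right hN)
  have hP : ∀ (N : ℕ) (s : ℝ), s ∈ Icc (0 : ℝ) (N + 1) → G ⌊s⌋₊ s = G N s := fun N s hs =>
    hGG _ _ s hs.1 (Nat.lt_floor_add_one s).le hs.2
  have hsol : ∀ s ∈ Ici (0 : ℝ),
      HasDerivWithinAt (fun s => G ⌊s⌋₊ s) (F (G ⌊s⌋₊ s)) (Ici 0) s := by
    intro s hs
    have hlt := Nat.lt_floor_add_one s
    have hmem : s ∈ Icc (0 : ℝ) (⌊s⌋₊ + 1) := ⟨hs, hlt.le⟩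
    have h1 : HasDerivWithinAt (fun s => G ⌊s⌋₊ s) (F (G ⌊s⌋₊ s)) (Icc 0 (⌊s⌋₊ + 1)) s :=
      (hG ⌊s⌋₊ s hmem).congr (fun t ht => hP _ t ht) rfl
    refine h1.mono_of_mem_nhdsWithin ?_
    rw [← Ici_inter_Iic]
    exact inter_mem_nhdsWithin _ (Iic_mem_nhds hlt)
  refine ⟨fun s => G ⌊s⌋₊ s, ⟨?_, hsol⟩, ?_⟩
  · simp [hG0]
  · rintro I hI h0 hI0 Q ⟨hQ0, hQ⟩ s hs
    have hsub : Icc 0 s ⊆ I := hI.out h0 hs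
    refine eqOn_Icc_of_integralCurves hL (b := s) (fun t ht => (hQ t (hsub ht)).mono hsub)
      (fun t ht => (hsol t ht.1).mono Icc_subset_Ici_self) ?_ ⟨hI0 hs, le_rfl⟩
    simp [hG0, hQ0]

end Flow

/-! ### Inverses depending affinely on a parameter -/

section Resolvent

variable {A W : Type*} [NormedRing A] [NormedAlgebra ℝ A] [CompleteSpace A]
  [NormedAddCommGroup W] [NormedSpace ℝ W]

/-- The derivative of `u ↦ (1 - (P + Q u))⁻¹` for a continuous linear map `Q`. -/
theorem hasFDerivAt_resolvent (P : A) (Q : W →L[ℝ] A) {u : W} (h : IsUnit (1 - (P + Q u))) :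
    HasFDerivAt (fun w => Ring.inverse (1 - (P + Q w)))
      ((ContinuousLinearMap.mulLeftRight ℝ A (Ring.inverse (1 - (P + Q u)))
        (Ring.inverse (1 - (P + Q u)))).comp Q) u := by
  obtain ⟨x, hx⟩ := h
  have h1 : HasFDerivAt (fun w => 1 - (P + Q w)) (-Q) u :=
    (Q.hasFDerivAt.const_add P).const_sub 1
  have h2 := hasFDerivAt_ringInverse (𝕜 := ℝ) x
  rw [hx] at h2
  have h3 := h2.comp u h1
  rw [← hx, Ring.inverse_unit]
  refine h3.congr_fderiv ?_
  ext v
  simp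

/-- If the inverse is bounded on bounded sets, its derivative is Lipschitz on bounded sets. -/
theorem exists_lipschitzOnWith_fderiv_resolvent (P : A) (Q : W →L[ℝ] A)
    (hunit : ∀ u, IsUnit (1 - (P + Q u)))
    (hbdd : ∀ r : ℝ, ∃ M : ℝ, ∀ u, ‖u‖ ≤ r → ‖Ring.inverse (1 - (P + Q u))‖ ≤ M) (r : ℝ) :
    ∃ K : ℝ≥0, LipschitzOnWith K (fderiv ℝ fun w => Ring.inverse (1 - (P + Q w)))
      (Metric.closedBall 0 r) := by
  obtain ⟨M, hM⟩ := hbdd r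
  have hM' : ∀ u, ‖u‖ ≤ r → ‖Ring.inverse (1 - (P + Q u))‖ ≤ |M| := fun u hu =>
    (hM u hu).trans (le_abs_self M)
  set R : W → A := fun w => Ring.inverse (1 - (P + Q w)) with hR
  -- The resolvent identity: a bound on R over the ball makes R itself Lipschitz there.
  have hdiff : ∀ u w, R u - R w = R u * Q (u - w) * R w := by
    intro u w
    have h1 : R u * (1 - (P + Q u)) = 1 := Ring.inverse_mul_cancel _ (hunit u)
    have h2 : (1 - (P + Q w)) * R w = 1 := Ring.mul_inverse_cancel _ (hunit w)
    calc R u - R w = R u * ((1 - (P + Q w)) * R w) - (R u * (1 - (P + Q u))) * R w := by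
          rw [h1, h2, mul_one, one_mul]
      _ = R u * Q (u - w) * R w := by rw [map_sub]; noncomm_ring
  refine ⟨⟨2 * |M| * ‖Q‖ * (|M| * ‖Q‖ * |M|), by positivity⟩,
    LipschitzOnWith.of_dist_le_mul fun u hu w hw => ?_⟩
  rw [mem_closedBall_zero_iff] at hu hw
  have hRR : ‖R u - R w‖ ≤ |M| * ‖Q‖ * |M| * ‖u - w‖ := by
    rw [hdiff]
    calc ‖R u * Q (u - w) * R w‖ ≤ ‖R u‖ * ‖Q (u - w)‖ * ‖R w‖ := norm_mul₃_le
      _ ≤ |M| * (‖Q‖ * ‖u - w‖) * |M| := by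
        gcongr
        · exact hM' u hu
        · exact Q.le_opNorm _
        · exact hM' w hw
      _ = _ := by ring
  rw [dist_eq_norm, dist_eq_norm, (hasFDerivAt_resolvent P Q (hunit u)).fderiv,
    (hasFDerivAt_resolvent P Q (hunit w)).fderiv]
  refine ContinuousLinearMap.opNorm_le_bound _
    (mul_nonneg (NNReal.coe_nonneg _) (norm_nonneg _)) fun v => ?_
  change ‖R u * Q v * R u - R w * Q v * R w‖ ≤
    2 * |M| * ‖Q‖ * (|M| * ‖Q‖ * |M|) * ‖u - w‖ * ‖v‖
  have e : R u * Q v * R u - R w * Q v * R w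
      = (R u - R w) * Q v * R u + R w * Q v * (R u - R w) := by noncomm_ring
  rw [e]
  calc _ ≤ ‖(R u - R w) * Q v * R u‖ + ‖R w * Q v * (R u - R w)‖ := norm_add_le _ _
    _ ≤ ‖R u - R w‖ * ‖Q v‖ * ‖R u‖ + ‖R w‖ * ‖Q v‖ * ‖R u - R w‖ :=
      add_le_add norm_mul₃_le norm_mul₃_le
    _ ≤ (|M| * ‖Q‖ * |M| * ‖u - w‖) * (‖Q‖ * ‖v‖) * |M|
        + |M| * (‖Q‖ * ‖v‖) * (|M| * ‖Q‖ * |M| * ‖u - w‖) := by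
      gcongr
      · exact Q.le_opNorm _
      · exact hM' u hu
      · exact hM' w hw
      · exact Q.le_opNorm _
    _ = _ := by ring

/-- If `1 - V` is conjugate to `1 - V'` with `‖V'‖ ≤ 1/2`, then it is invertible, with a bound on
the inverse. -/
theorem isUnit_one_sub_of_conj {A : Type*} [NormedRing A] [CompleteSpace A] {V S S' : A} (h : S * S' = 1) (h' : S' * S = 1)
    (hV : ‖S' * V * S‖ ≤ 1 / 2) :
    IsUnit (1 - V) ∧ ‖Ring.inverse (1 - V)‖ ≤ ‖S‖ * (‖(1 : A)‖ + 1) * ‖S'‖ := by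
  have hlt : ‖S' * V * S‖ < 1 := by linarith
  set t := S' * V * S with ht
  have hVt : 1 - V = S * (1 - t) * S' := by
    have : S * t * S' = V := by
      rw [ht]
      calc S * (S' * V * S) * S' = (S * S') * V * (S * S') := by noncomm_ring
        _ = V := by rw [h, one_mul, mul_one]
    rw [mul_sub, sub_mul, mul_one, h, this]
  have hu : IsUnit (1 - t) := isUnit_one_sub_of_norm_lt_one hlt
  have c1 := Ring.mul_inverse_cancel _ hu
  have c2 := Ring.inverse_mul_cancel _ hu
  set g := Ring.inverse (1 - t) with hg
  have m1 : (1 - V) * (S * g * S') = 1 := by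
    calc (1 - V) * (S * g * S') = S * (1 - t) * (S' * S) * g * S' := by rw [hVt]; noncomm_ring
      _ = S * ((1 - t) * g) * S' := by rw [h']; noncomm_ring
      _ = 1 := by rw [c1, mul_one, h]
  have m2 : (S * g * S') * (1 - V) = 1 := by
    calc (S * g * S') * (1 - V) = S * g * (S' * S) * (1 - t) * S' := by rw [hVt]; noncomm_ring
      _ = S * (g * (1 - t)) * S' := by rw [h']; noncomm_ring
      _ = 1 := by rw [c2, mul_one, h]
  have hinv : Ring.inverse (1 - V) = S * g * S' := Ring.inverse_unit ⟨1 - V, _, m1, m2⟩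
  refine ⟨⟨⟨1 - V, _, m1, m2⟩, rfl⟩, ?_⟩
  rw [hinv]
  refine norm_mul₃_le.trans ?_
  gcongr
  have hgt : g = ∑' n : ℕ, t ^ n := by
    rw [hg, (hasSum_geom_series_inverse t hlt).tsum_eq]
  rw [hgt]
  -- The Neumann series is bounded by ‖1‖ - 1 + (1 - ‖t‖)⁻¹. The norm of 1 is kept because the
  -- algebra may be trivial.
  refine (tsum_geometric_le_of_norm_lt_one t hlt).trans ?_
  have : (1 - ‖t‖)⁻¹ ≤ 2 := inv_le_of_inv_le₀ (by norm_num) (by linarith)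
  linarith

variable {Z E : Type*} [NormedAddCommGroup Z] [NormedSpace ℝ Z] [CompleteSpace Z]
  [NormedAddCommGroup E] [NormedSpace ℝ E]

theorem differentiable_resolvent_apply (L : Z →L[ℝ] E) (c : Z) (P : Z →L[ℝ] Z)
    (Q : W →L[ℝ] Z →L[ℝ] Z) (hunit : ∀ u, IsUnit (1 - (P + Q u))) :
    Differentiable ℝ fun w => L (Ring.inverse (1 - (P + Q w)) c) := fun u =>
  ((L.comp (ContinuousLinearMap.apply ℝ Z c)).hasFDerivAt.comp u
    (hasFDerivAt_resolvent P Q (hunit u))).differentiableAt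

theorem exists_lipschitzOnWith_fderiv_resolvent_apply (L : Z →L[ℝ] E) (c : Z) (P : Z →L[ℝ] Z)
    (Q : W →L[ℝ] Z →L[ℝ] Z) (hunit : ∀ u, IsUnit (1 - (P + Q u)))
    (hbdd : ∀ r : ℝ, ∃ M : ℝ, ∀ u, ‖u‖ ≤ r → ‖Ring.inverse (1 - (P + Q u))‖ ≤ M) (r : ℝ) :
    ∃ K : ℝ≥0, LipschitzOnWith K (fderiv ℝ fun w => L (Ring.inverse (1 - (P + Q w)) c))
      (Metric.closedBall 0 r) := by
  obtain ⟨K, hK⟩ := exists_lipschitzOnWith_fderiv_resolvent P Q hunit hbdd r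
  have heq : (fderiv ℝ fun w => L (Ring.inverse (1 - (P + Q w)) c)) = fun u =>
      ContinuousLinearMap.compL ℝ _ _ _ (L.comp (ContinuousLinearMap.apply ℝ Z c))
        (fderiv ℝ (fun w => Ring.inverse (1 - (P + Q w))) u) := by
    funext u
    exact ((L.comp (ContinuousLinearMap.apply ℝ Z c)).hasFDerivAt.comp u
      (hasFDerivAt_resolvent P Q (hunit u)).differentiableAt.hasFDerivAt).fderiv
  rw [heq]
  exact ⟨_, (ContinuousLinearMap.lipschitz _).comp_lipschitzOnWith hK⟩

end Resolvent

/-! ### The Volterra operator and its exponentially weighted norm -/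

section Volterra

variable {E : Type*} [NormedAddCommGroup E] [NormedSpace ℝ E] {T : ℝ}

theorem integrableOn_control (u : Control T) : IntegrableOn u (Icc 0 T) :=
  (Lp.memLp u).integrable one_le_two

theorem integral_sq_control (u : Control T) : ∫ s in Icc 0 T, (u s) ^ 2 = ‖u‖ ^ 2 := by
  rw [← real_inner_self_eq_norm_sq, L2.inner_def]
  refine integral_congr_ae (Filter.Eventually.of_forall fun s => ?_)
  simp [sq]

theorem integrableOn_control_smul (u : Control T) {f : ℝ → E} (hf : ContinuousOn f (Icc 0 T)) :
    IntegrableOn (fun s => u s • f s) (Icc 0 T) :=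
  (integrableOn_control u).smul_continuousOn hf isCompact_Icc

theorem intervalIntegrable_control_smul (u : Control T) {f : ℝ → E}
    (hf : ContinuousOn f (Icc 0 T)) {t : ℝ} (ht : t ∈ Icc 0 T) :
    IntervalIntegrable (fun s => u s • f s) volume 0 t := by
  rw [intervalIntegrable_iff_integrableOn_Icc_of_le ht.1]
  exact (integrableOn_control_smul u hf).mono_set (Icc_subset_Icc_right ht.2)

/-- Cauchy-Schwarz with an exponential weight. -/
theorem norm_integral_control_smul_le (u : Control T) {f : ℝ → E} {m l : ℝ} (hl : 0 < l)
    (hm : 0 ≤ m) (hfm : ∀ s ∈ Icc 0 T, ‖f s‖ ≤ m * Real.exp (l * s)) {t : ℝ} (ht : t ∈ Icc 0 T) :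
    ‖∫ s in (0 : ℝ)..t, u s • f s‖ ≤ ‖u‖ * (m * Real.exp (l * t) / √(2 * l)) := by
  have hsub : Ioc 0 t ⊆ Icc 0 T := Ioc_subset_Icc_self.trans (Icc_subset_Icc_right ht.2)
  set g : ℝ → ℝ := fun s => m * Real.exp (l * s) with hg
  have hgc : Continuous g := by fun_prop
  have hu2 : MemLp (fun s => |u s|) 2 (volume.restrict (Ioc 0 t)) :=
    ((Lp.memLp u).mono_measure (Measure.restrict_mono hsub le_rfl)).norm
  have hg2 : MemLp g 2 (volume.restrict (Ioc 0 t)) := by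
    rw [memLp_two_iff_integrable_sq hgc.aestronglyMeasurable]
    exact ((hgc.pow 2).integrableOn_Icc).mono_set Ioc_subset_Icc_self
  rw [intervalIntegral.integral_of_le ht.1]
  have h1 : ‖∫ s in Ioc 0 t, u s • f s‖ ≤ ∫ s in Ioc 0 t, |u s| * g s := by
    refine norm_integral_le_of_norm_le (hu2.integrable_mul hg2) ?_
    refine ae_restrict_of_forall_mem measurableSet_Ioc fun s hs => ?_
    rw [norm_smul, Real.norm_eq_abs]
    exact mul_le_mul_of_nonneg_left (hfm s (hsub hs)) (abs_nonneg _)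
  -- The factor 1/√(2l) comes from ∫₀ᵗ exp(2ls) ds ≤ exp(2lt)/(2l). It is the gain that beats any
  -- bounded set of controls for large l.
  have h2 := integral_mul_le_Lp_mul_Lq_of_nonneg (μ := volume.restrict (Ioc 0 t))
    Real.HolderConjugate.two_two (f := fun s => |u s|) (g := g)
    (Filter.Eventually.of_forall fun s => abs_nonneg _)
    (Filter.Eventually.of_forall fun s => by positivity) (by simpa using hu2) (by simpa using hg2)
  simp only [← Real.sqrt_eq_rpow, Real.rpow_two, sq_abs] at h2
  have h3 : √(∫ s in Ioc 0 t, (u s) ^ 2) ≤ ‖u‖ := by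
    rw [Real.sqrt_le_left (norm_nonneg _), ← integral_sq_control]
    refine setIntegral_mono_set ?_ (Filter.Eventually.of_forall fun s => sq_nonneg _)
      hsub.eventuallyLE
    exact (Lp.memLp u).integrable_sq
  have h4 : √(∫ s in Ioc 0 t, (g s) ^ 2) ≤ m * Real.exp (l * t) / √(2 * l) := by
    rw [Real.sqrt_le_left (by positivity), div_pow, Real.sq_sqrt (by positivity),
      ← intervalIntegral.integral_of_le ht.1]
    have hder : ∀ s ∈ uIcc 0 t,
        HasDerivAt (fun s => m ^ 2 * Real.exp (2 * l * s) / (2 * l)) ((g s) ^ 2) s := by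
      intro s _
      have h := ((((hasDerivAt_id s).const_mul (2 * l)).exp).const_mul (m ^ 2)).div_const (2 * l)
      refine h.congr_deriv ?_
      have : Real.exp (2 * l * s) = Real.exp (l * s) ^ 2 := by
        rw [← Real.exp_nat_mul]; congr 1; push_cast; ring
      simp only [id, hg, this]
      field_simp
    rw [intervalIntegral.integral_eq_sub_of_hasDerivAt hder
      ((hgc.pow 2).intervalIntegrable _ _)]
    have : Real.exp (2 * l * t) = Real.exp (l * t) ^ 2 := by
      rw [← Real.exp_nat_mul]; congr 1; push_cast; ring
    rw [this, mul_pow]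
    exact sub_le_self _ (by positivity)
  refine h1.trans (h2.trans ?_)
  exact mul_le_mul h3 h4 (Real.sqrt_nonneg _) (norm_nonneg _)

/-- The operator `(u, f) ↦ (t ↦ ∫₀ᵗ u f)`, at a pair of arguments. -/
def integralMap (hT : 0 ≤ T) (u : Control T) (f : C(Icc (0 : ℝ) T, E)) : C(Icc (0 : ℝ) T, E) where
  toFun t := ∫ s in (0 : ℝ)..t, u s • f (projIcc 0 T hT s)
  continuous_toFun := by
    have h := intervalIntegral.continuousOn_primitive_interval
      (f := fun s => u s • f (projIcc 0 T hT s)) (a := 0) (b := T) (μ := volume)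
      (by
        rw [uIcc_of_le hT]
        exact integrableOn_control_smul u (by fun_prop))
    rw [uIcc_of_le hT] at h
    exact continuousOn_iff_continuous_domRestrict.1 h

theorem integralMap_apply (hT : 0 ≤ T) (u : Control T) (f : C(Icc (0 : ℝ) T, E))
    (t : Icc (0 : ℝ) T) :
    integralMap hT u f t = ∫ s in (0 : ℝ)..t, u s • f (projIcc 0 T hT s) := rfl

theorem norm_integralMap_apply_le (hT : 0 ≤ T) (u : Control T) (f : C(Icc (0 : ℝ) T, E))
    {m l : ℝ} (hl : 0 < l) (hm : 0 ≤ m) (hfm : ∀ s : Icc (0 : ℝ) T, ‖f s‖ ≤ m * Real.exp (l * s))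
    (t : Icc (0 : ℝ) T) :
    ‖integralMap hT u f t‖ ≤ ‖u‖ * (m * Real.exp (l * t) / √(2 * l)) := by
  refine norm_integral_control_smul_le u hl hm (fun s hs => ?_) t.2
  rw [projIcc_of_mem hT hs]
  exact hfm ⟨s, hs⟩

theorem ae_restrict_Ioc_of_ae_Icc {t : ℝ} (ht : t ∈ Icc 0 T) {p : ℝ → Prop}
    (h : ∀ᵐ s ∂volume.restrict (Icc 0 T), p s) :
    ∀ᵐ s ∂volume.restrict (Ioc 0 t), p s :=
  ae_mono (Measure.restrict_mono (Ioc_subset_Icc_self.trans (Icc_subset_Icc_right ht.2)) le_rfl) h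

/-- The operator `(u, f) ↦ (t ↦ ∫₀ᵗ u f)` as a continuous bilinear map. -/
def integralCLM (E : Type*) [NormedAddCommGroup E] [NormedSpace ℝ E] (hT : 0 ≤ T) :
    Control T →L[ℝ] C(Icc (0 : ℝ) T, E) →L[ℝ] C(Icc (0 : ℝ) T, E) :=
  LinearMap.mkContinuous₂
    (LinearMap.mk₂ ℝ (integralMap hT)
      (by
        intro u v f
        ext t
        simp only [ContinuousMap.add_apply, integralMap_apply]
        rw [← intervalIntegral.integral_add
          (intervalIntegrable_control_smul u (by fun_prop) t.2)
          (intervalIntegrable_control_smul v (by fun_prop) t.2),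
          intervalIntegral.integral_of_le t.2.1, intervalIntegral.integral_of_le t.2.1]
        refine integral_congr_ae ?_
        filter_upwards [ae_restrict_Ioc_of_ae_Icc t.2 (Lp.coeFn_add u v)] with s hs
        rw [hs, Pi.add_apply, add_smul])
      (by
        intro c u f
        ext t
        simp only [ContinuousMap.smul_apply, integralMap_apply]
        rw [← intervalIntegral.integral_smul,
          intervalIntegral.integral_of_le t.2.1, intervalIntegral.integral_of_le t.2.1]
        refine integral_congr_ae ?_
        filter_upwards [ae_restrict_Ioc_of_ae_Icc t.2 (Lp.coeFn_smul c u)] with s hs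
        rw [hs, Pi.smul_apply, smul_assoc])
      (by
        intro u f g
        ext t
        simp only [ContinuousMap.add_apply, integralMap_apply]
        rw [← intervalIntegral.integral_add
          (intervalIntegrable_control_smul u (by fun_prop) t.2)
          (intervalIntegrable_control_smul u (by fun_prop) t.2)]
        simp only [smul_add])
      (by
        intro c u f
        ext t
        simp only [ContinuousMap.smul_apply, integralMap_apply]
        rw [← intervalIntegral.integral_smul]
        simp only [smul_comm c]))
    -- Taking l = 1/2 makes √(2l) = 1, which leaves the factor exp(t/2) ≤ exp T.
    (Real.exp T)
    (by
      intro u f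
      refine (ContinuousMap.norm_le _ (by positivity)).2 fun t => ?_
      have h := norm_integralMap_apply_le hT u f (m := ‖f‖) (l := 1 / 2) (by norm_num)
        (norm_nonneg _) (fun s => (f.norm_coe_le_norm s).trans ?_) t
      · have h2 : √(2 * (1 / 2 : ℝ)) = 1 := by norm_num
        rw [h2, div_one] at h
        refine h.trans ?_
        have : Real.exp (1 / 2 * t) ≤ Real.exp T := by
          apply Real.exp_le_exp.2
          have := t.2.1
          have := t.2.2
          linarith
        calc ‖u‖ * (‖f‖ * Real.exp (1 / 2 * t)) ≤ ‖u‖ * (‖f‖ * Real.exp T) := by gcongr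
          _ = _ := by ring
      · refine le_mul_of_one_le_right (norm_nonneg _) (Real.one_le_exp ?_)
        have := s.2.1
        linarith)

/-- Multiplication by `t ↦ exp (l t)`. -/
def expMul (E : Type*) [NormedAddCommGroup E] [NormedSpace ℝ E] (T l : ℝ) :
    C(Icc (0 : ℝ) T, E) →L[ℝ] C(Icc (0 : ℝ) T, E) :=
  LinearMap.mkContinuous
    { toFun := fun f => ⟨fun t => Real.exp (l * t) • f t, by fun_prop⟩
      map_add' := fun f g => by ext t; simp
      map_smul' := fun c f => by ext t; simp [smul_comm c] }
    (Real.exp (|l| * T))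
    (by
      intro f
      refine (ContinuousMap.norm_le _ (by positivity)).2 fun t => ?_
      simp only [LinearMap.coe_mk, AddHom.coe_mk, ContinuousMap.coe_mk, norm_smul,
        Real.norm_eq_abs, Real.abs_exp]
      have h0 := t.2.1
      have h1 := t.2.2
      have : l * t ≤ |l| * T := by
        calc l * t ≤ |l| * t := by gcongr; exact le_abs_self l
          _ ≤ |l| * T := by gcongr
      gcongr
      exact f.norm_coe_le_norm t)

theorem expMul_apply (l : ℝ) (f : C(Icc (0 : ℝ) T, E)) (t : Icc (0 : ℝ) T) :
    expMul E T l f t = Real.exp (l * t) • f t := rfl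

theorem expMul_mul_neg (l : ℝ) : expMul E T l * expMul E T (-l) = 1 := by
  ext f t
  change Real.exp (l * t) • Real.exp (-l * t) • f t = f t
  rw [smul_smul, ← Real.exp_add]
  simp

/-- The control that is constantly one. -/
def oneControl (T : ℝ) : Control T := Lp.const 2 (volume.restrict (Icc (0 : ℝ) T)) (1 : ℝ)

theorem coeFn_oneControl : oneControl T =ᵐ[volume.restrict (Icc (0 : ℝ) T)] fun _ => 1 :=
  Lp.coeFn_const ..

theorem integralMap_oneControl (hT : 0 ≤ T) (f : C(Icc (0 : ℝ) T, E)) (t : Icc (0 : ℝ) T) :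
    integralMap hT (oneControl T) f t = ∫ s in (0 : ℝ)..t, f (projIcc 0 T hT s) := by
  rw [integralMap_apply, intervalIntegral.integral_of_le t.2.1,
    intervalIntegral.integral_of_le t.2.1]
  refine integral_congr_ae ?_
  filter_upwards [ae_restrict_Ioc_of_ae_Icc t.2 coeFn_oneControl] with s hs
  rw [hs, one_smul]

/-- The drift part of the Volterra operator of `x' = (A₀ + u A₁) x`. -/
def volterraDrift (hT : 0 ≤ T) (A₀ : E →L[ℝ] E) : C(Icc (0 : ℝ) T, E) →L[ℝ] C(Icc (0 : ℝ) T, E) :=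
  (A₀.compLeftContinuous ℝ (Icc (0 : ℝ) T)).comp (integralCLM E hT (oneControl T))

/-- The control part of the Volterra operator of `x' = (A₀ + u A₁) x`. -/
def volterraControl (hT : 0 ≤ T) (A₁ : E →L[ℝ] E) :
    Control T →L[ℝ] C(Icc (0 : ℝ) T, E) →L[ℝ] C(Icc (0 : ℝ) T, E) :=
  (ContinuousLinearMap.compL ℝ _ _ _ (A₁.compLeftContinuous ℝ (Icc (0 : ℝ) T))).comp
    (integralCLM E hT)

theorem volterra_apply (hT : 0 ≤ T) (A₀ A₁ : E →L[ℝ] E) (u : Control T)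
    (f : C(Icc (0 : ℝ) T, E)) (t : Icc (0 : ℝ) T) :
    (volterraDrift hT A₀ + volterraControl hT A₁ u) f t
      = A₀ (integralMap hT (oneControl T) f t) + A₁ (integralMap hT u f t) := rfl

/-- Conjugation by exp(lt) amounts to using the weighted norm sup exp(-lt)‖f t‖, in which
integration against a control costs ‖u‖/√(2l). For large l the operator is a contraction on the
whole interval, uniformly for controls in a ball. -/
theorem volterra_resolvent [CompleteSpace E] (hT : 0 ≤ T) (A₀ A₁ : E →L[ℝ] E) (r : ℝ) :
    ∃ M : ℝ, ∀ u : Control T, ‖u‖ ≤ r →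
      IsUnit (1 - (volterraDrift hT A₀ + volterraControl hT A₁ u)) ∧
      ‖Ring.inverse (1 - (volterraDrift hT A₀ + volterraControl hT A₁ u))‖ ≤ M := by
  set K : ℝ := ‖A₀‖ * ‖oneControl T‖ + ‖A₁‖ * |r| with hK
  have hK0 : 0 ≤ K := by positivity
  -- Chosen so that K/√(2l) ≤ 1/2; the added 1 keeps l positive when K = 0.
  set l : ℝ := 2 * K ^ 2 + 1 with hl
  have hl0 : 0 < l := by positivity
  have hs0 : 0 < √(2 * l) := by positivity
  have hsq : 2 * K ≤ √(2 * l) := Real.le_sqrt_of_sq_le (by nlinarith)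
  refine ⟨‖expMul E T l‖ * (‖(1 : C(Icc (0 : ℝ) T, E) →L[ℝ] C(Icc (0 : ℝ) T, E))‖ + 1)
    * ‖expMul E T (-l)‖, fun u hu => ?_⟩
  have hinv : expMul E T (-l) * expMul E T l = 1 := by
    simpa only [neg_neg] using expMul_mul_neg (E := E) (T := T) (-l)
  refine isUnit_one_sub_of_conj (A := C(Icc (0 : ℝ) T, E) →L[ℝ] C(Icc (0 : ℝ) T, E))
    (S := expMul E T l) (S' := expMul E T (-l)) (expMul_mul_neg l) hinv ?_
  refine ContinuousLinearMap.opNorm_le_bound _ (by norm_num) fun f => ?_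
  refine (ContinuousMap.norm_le _ (by positivity)).2 fun t => ?_
  change ‖Real.exp (-l * t) • (A₀ (integralMap hT (oneControl T) (expMul E T l f) t)
    + A₁ (integralMap hT u (expMul E T l f) t))‖ ≤ 1 / 2 * ‖f‖
  have hb : ∀ s : Icc (0 : ℝ) T, ‖expMul E T l f s‖ ≤ ‖f‖ * Real.exp (l * s) := by
    intro s
    rw [expMul_apply, norm_smul, Real.norm_eq_abs, Real.abs_exp, mul_comm]
    gcongr
    exact f.norm_coe_le_norm s
  have i1 := norm_integralMap_apply_le hT (oneControl T) _ hl0 (norm_nonneg f) hb t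
  have i2 := norm_integralMap_apply_le hT u _ hl0 (norm_nonneg f) hb t
  set q := ‖f‖ * Real.exp (l * t) / √(2 * l) with hq
  have hq0 : 0 ≤ q := by positivity
  have i3 : ‖A₀ (integralMap hT (oneControl T) (expMul E T l f) t)
      + A₁ (integralMap hT u (expMul E T l f) t)‖ ≤ K * q := by
    calc _ ≤ ‖A₀‖ * (‖oneControl T‖ * q) + ‖A₁‖ * (|r| * q) := by
          refine norm_add_le_of_le ((A₀.le_opNorm _).trans ?_) ((A₁.le_opNorm _).trans ?_)
          · gcongr
          · gcongr
            exact i2.trans (by gcongr; exact hu.trans (le_abs_self r))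
      _ = K * q := by rw [hK]; ring
  rw [norm_smul, Real.norm_eq_abs, Real.abs_exp]
  calc _ ≤ Real.exp (-l * t) * (K * q) := by gcongr
    _ = (K / √(2 * l)) * ‖f‖ * (Real.exp (-l * t) * Real.exp (l * t)) := by rw [hq]; ring
    _ = (K / √(2 * l)) * ‖f‖ := by rw [← Real.exp_add]; simp
    _ ≤ 1 / 2 * ‖f‖ := by
      refine mul_le_mul_of_nonneg_right ?_ (norm_nonneg _)
      rw [div_le_iff₀ hs0]
      linarith

end Volterra

/-! ### Solutions of the integral equation and their dependence on the control -/

section Solution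

variable {E : Type*} [NormedAddCommGroup E] [NormedSpace ℝ E] [CompleteSpace E] {T : ℝ}

/-- The Carathéodory solution of `x' = (A₀ + u A₁) x`, `x 0 = x₀`, on `[0, T]`. -/
def solution (hT : 0 ≤ T) (A₀ A₁ : E →L[ℝ] E) (x₀ : E) (u : Control T) : C(Icc (0 : ℝ) T, E) :=
  Ring.inverse (1 - (volterraDrift hT A₀ + volterraControl hT A₁ u)) (ContinuousMap.const _ x₀)

theorem isUnit_one_sub_volterra (hT : 0 ≤ T) (A₀ A₁ : E →L[ℝ] E) (u : Control T) :
    IsUnit (1 - (volterraDrift hT A₀ + volterraControl hT A₁ u)) := by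
  obtain ⟨M, hM⟩ := volterra_resolvent hT A₀ A₁ ‖u‖
  exact (hM u le_rfl).1

/-- Invertibility of 1 - V gives existence and uniqueness of the fixed point together. -/
theorem eq_solution_iff (hT : 0 ≤ T) (A₀ A₁ : E →L[ℝ] E) (x₀ : E) (u : Control T)
    (f : C(Icc (0 : ℝ) T, E)) :
    f = solution hT A₀ A₁ x₀ u ↔
      f = ContinuousMap.const _ x₀ + (volterraDrift hT A₀ + volterraControl hT A₁ u) f := by
  have hu := isUnit_one_sub_volterra hT A₀ A₁ u
  set V := volterraDrift hT A₀ + volterraControl hT A₁ u with hV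
  have key : f = ContinuousMap.const _ x₀ + V f ↔ (1 - V) f = ContinuousMap.const _ x₀ := by
    change _ ↔ f - V f = _
    rw [sub_eq_iff_eq_add]
  rw [key]
  constructor
  · rintro rfl
    change ((1 - V) * Ring.inverse (1 - V)) _ = _
    rw [Ring.mul_inverse_cancel _ hu]
    rfl
  · intro h
    rw [solution, ← hV, ← h]
    change _ = (Ring.inverse (1 - V) * (1 - V)) f
    rw [Ring.inverse_mul_cancel _ hu]
    rfl

theorem volterra_apply_eq_integral (hT : 0 ≤ T) (A₀ A₁ : E →L[ℝ] E) (u : Control T)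
    (f : C(Icc (0 : ℝ) T, E)) (t : Icc (0 : ℝ) T) :
    (volterraDrift hT A₀ + volterraControl hT A₁ u) f t
      = ∫ s in (0 : ℝ)..t, (A₀ (f (projIcc 0 T hT s)) + u s • A₁ (f (projIcc 0 T hT s))) := by
  rw [volterra_apply, integralMap_oneControl, integralMap_apply]
  rw [← ContinuousLinearMap.intervalIntegral_comp_comm A₀
      ((show Continuous fun s => f (projIcc 0 T hT s) by fun_prop).intervalIntegrable _ _),
    ← ContinuousLinearMap.intervalIntegral_comp_comm A₁
      (intervalIntegrable_control_smul u (by fun_prop) t.2)]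
  simp only [map_smul]
  rw [intervalIntegral.integral_add]
  · exact (show Continuous fun s => A₀ (f (projIcc 0 T hT s)) by fun_prop).intervalIntegrable _ _
  · exact intervalIntegrable_control_smul u (by fun_prop) t.2

theorem solution_apply (hT : 0 ≤ T) (A₀ A₁ : E →L[ℝ] E) (x₀ : E) (u : Control T)
    (t : Icc (0 : ℝ) T) :
    solution hT A₀ A₁ x₀ u t = x₀ + ∫ s in (0 : ℝ)..t,
      (A₀ (solution hT A₀ A₁ x₀ u (projIcc 0 T hT s))
        + u s • A₁ (solution hT A₀ A₁ x₀ u (projIcc 0 T hT s))) := by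
  have h := (eq_solution_iff hT A₀ A₁ x₀ u _).1 rfl
  rw [← volterra_apply_eq_integral hT A₀ A₁ u]
  exact DFunLike.congr_fun h t

/-- A function on `[0, T]` solves the integral equation iff it is `solution`. -/
theorem integral_equation_iff (hT : 0 ≤ T) (A₀ A₁ : E →L[ℝ] E) (x₀ : E) (u : Control T)
    (x : ℝ → E) :
    (ContinuousOn x (Icc 0 T) ∧ ∀ t ∈ Icc 0 T,
      x t = x₀ + ∫ s in (0 : ℝ)..t, (A₀ (x s) + u s • A₁ (x s))) ↔
    ∀ t : Icc (0 : ℝ) T, x t = solution hT A₀ A₁ x₀ u t := by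
  have congr_int : ∀ (f : C(Icc (0 : ℝ) T, E)) (_ : ∀ t : Icc (0 : ℝ) T, x t = f t)
      (t : Icc (0 : ℝ) T), ∫ s in (0 : ℝ)..t, (A₀ (x s) + u s • A₁ (x s))
        = ∫ s in (0 : ℝ)..t, (A₀ (f (projIcc 0 T hT s)) + u s • A₁ (f (projIcc 0 T hT s))) := by
    intro f hf t
    refine intervalIntegral.integral_congr fun s hs => ?_
    rw [uIcc_of_le t.2.1] at hs
    have hs' : s ∈ Icc 0 T := ⟨hs.1, hs.2.trans t.2.2⟩
    simp only [projIcc_of_mem hT hs', ← hf ⟨s, hs'⟩]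
  constructor
  · rintro ⟨hc, hx⟩ t
    have h : (⟨_, hc.domRestrict⟩ : C(Icc (0 : ℝ) T, E)) = solution hT A₀ A₁ x₀ u := by
      rw [eq_solution_iff]
      ext t
      rw [ContinuousMap.add_apply, volterra_apply_eq_integral, ← congr_int _ (fun _ => rfl)]
      exact hx t t.2
    exact DFunLike.congr_fun h t
  · intro hx
    refine ⟨?_, fun t ht => ?_⟩
    · rw [continuousOn_iff_continuous_domRestrict]
      exact (solution hT A₀ A₁ x₀ u).continuous.congr fun t => (hx t).symm
    · rw [congr_int _ hx ⟨t, ht⟩, ← solution_apply]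
      exact hx ⟨t, ht⟩

/-- For a continuous control, the solution is a classical one. -/
theorem exists_hasDerivAt_solution (hT : 0 ≤ T) (A₀ A₁ : E →L[ℝ] E) (x₀ : E) {u : Control T}
    {w : ℝ → ℝ} (hw : Continuous w) (hu : u =ᵐ[volume.restrict (Icc 0 T)] w) :
    ∃ y : ℝ → E, Continuous y ∧ y 0 = x₀ ∧ (∀ t : Icc (0 : ℝ) T, y t = solution hT A₀ A₁ x₀ u t) ∧
      ∀ t ∈ Icc 0 T, HasDerivAt y (A₀ (y t) + w t • A₁ (y t)) t := by
  set x := solution hT A₀ A₁ x₀ u with hx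
  set g : ℝ → E := fun s => A₀ (x (projIcc 0 T hT s)) + w s • A₁ (x (projIcc 0 T hT s)) with hg
  have hgc : Continuous g := by fun_prop
  have hder : ∀ t, HasDerivAt (fun t => x₀ + ∫ s in (0 : ℝ)..t, g s) (g t) t := fun t =>
    (intervalIntegral.integral_hasDerivAt_right (hgc.intervalIntegrable _ _)
      (hgc.stronglyMeasurableAtFilter _ _) hgc.continuousAt).const_add x₀
  have heq : ∀ t : Icc (0 : ℝ) T, x₀ + ∫ s in (0 : ℝ)..t, g s = x t := by
    intro t
    rw [hx, solution_apply, ← hx]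
    congr 1
    rw [intervalIntegral.integral_of_le t.2.1, intervalIntegral.integral_of_le t.2.1]
    refine integral_congr_ae ?_
    filter_upwards [ae_restrict_Ioc_of_ae_Icc t.2 hu] with s hs
    rw [hs]
  refine ⟨fun t => x₀ + ∫ s in (0 : ℝ)..t, g s,
    continuous_iff_continuousAt.2 fun t => (hder t).continuousAt, by simp, heq, fun t ht => ?_⟩
  have := hder t
  simp only [heq ⟨t, ht⟩]
  simpa only [hg, projIcc_of_mem hT ht] using this

theorem differentiable_solution (hT : 0 ≤ T) (A₀ A₁ : E →L[ℝ] E) (x₀ : E) (t : Icc (0 : ℝ) T) :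
    Differentiable ℝ fun u : Control T => solution hT A₀ A₁ x₀ u t := by
  have hu := isUnit_one_sub_volterra (T := T) hT A₀ A₁
  have h := differentiable_resolvent_apply (W := Control T) (Z := C(Icc (0 : ℝ) T, E)) (E := E)
    (ContinuousMap.evalCLM ℝ t) (ContinuousMap.const _ x₀)
    (volterraDrift hT A₀) (volterraControl hT A₁) hu
  exact h

theorem exists_lipschitzOnWith_fderiv_solution (hT : 0 ≤ T) (A₀ A₁ : E →L[ℝ] E) (x₀ : E)
    (t : Icc (0 : ℝ) T) (r : ℝ) :
    ∃ K : ℝ≥0, LipschitzOnWith K (fderiv ℝ fun u : Control T => solution hT A₀ A₁ x₀ u t)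
      (Metric.closedBall 0 r) := by
  have hu := isUnit_one_sub_volterra (T := T) hT A₀ A₁
  have hb : ∀ r : ℝ, ∃ M : ℝ, ∀ u : Control T, ‖u‖ ≤ r →
      ‖Ring.inverse (1 - (volterraDrift hT A₀ + volterraControl hT A₁ u))‖ ≤ M :=
    fun r => (volterra_resolvent hT A₀ A₁ r).imp fun _ hM u hu => (hM u hu).2
  have h := exists_lipschitzOnWith_fderiv_resolvent_apply (W := Control T)
    (Z := C(Icc (0 : ℝ) T, E)) (E := E) (ContinuousMap.evalCLM ℝ t) (ContinuousMap.const _ x₀)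
    (volterraDrift hT A₀) (volterraControl hT A₁) hu hb r
  exact h

/-- Controls with a continuous representative are dense. -/
theorem control_induction {p : Control T → Prop} (hp : IsClosed {u | p u})
    (h : ∀ (u : Control T) (w : ℝ → ℝ), Continuous w →
      u =ᵐ[volume.restrict (Icc 0 T)] w → p u) (u : Control T) : p u := by
  have hd : DenseRange (BoundedContinuousFunction.toLp 2 (volume.restrict (Icc (0 : ℝ) T)) ℝ :
      (BoundedContinuousFunction ℝ ℝ) →L[ℝ] Control T) :=
    BoundedContinuousFunction.toLp_denseRange _ _ ℝ (by simp)
  exact hd.induction_on u hp fun w => h _ w w.continuous (BoundedContinuousFunction.coeFn_toLp 2 _ ℝ w)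

end Solution

/-! ### Unitary propagators, conjugation and uniform Lipschitz bounds -/

section Propagator

variable {A : Type*} [NormedRing A] [NormedAlgebra ℝ A] {T : ℝ}

/-- Left multiplication by `a`. -/
def mulCLM (a : A) : A →L[ℝ] A := ContinuousLinearMap.mul ℝ A a

/-- The commutator `x ↦ [a, x]`. -/
def commCLM (a : A) : A →L[ℝ] A :=
  ContinuousLinearMap.mul ℝ A a - (ContinuousLinearMap.mul ℝ A).flip a

theorem mulCLM_apply (a x : A) : mulCLM a x = a * x := rfl

theorem commCLM_apply (a x : A) : commCLM a x = a * x - x * a := rfl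

theorem mulCLM_add_smul (a b x : A) (c : ℝ) :
    mulCLM a x + c • mulCLM b x = (a + c • b) * x := by
  simp only [mulCLM_apply, add_mul, smul_mul_assoc]

theorem commCLM_add_smul (a b x : A) (c : ℝ) :
    commCLM a x + c • commCLM b x = (a + c • b) * x - x * (a + c • b) := by
  simp only [commCLM_apply, add_mul, mul_add, smul_mul_assoc, mul_smul_comm, smul_sub]
  abel

/-- A function on `[0, b]` with zero derivative is constant. -/
theorem eq_of_hasDerivAt_zero {E : Type*} [NormedAddCommGroup E] [NormedSpace ℝ E] {f : ℝ → E}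
    {b : ℝ} (hf : ∀ t ∈ Icc 0 b, HasDerivAt f 0 t) {t : ℝ} (ht : t ∈ Icc 0 b) : f t = f 0 :=
  constant_of_has_deriv_right_zero (fun t ht => (hf t ht).continuousAt.continuousWithinAt)
    (fun t ht => (hf t (Ico_subset_Icc_self ht)).hasDerivWithinAt) t ht

variable [CompleteSpace A]

/-- The endpoint `U(T)` of the propagator `U' = (H₀ + u H₁) U`, `U(0) = 1`. -/
def propagator (hT : 0 ≤ T) (H₀ H₁ : A) (u : Control T) : A :=
  solution hT (mulCLM H₀) (mulCLM H₁) 1 u ⟨T, hT, le_rfl⟩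

theorem differentiable_propagator (hT : 0 ≤ T) (H₀ H₁ : A) :
    Differentiable ℝ fun u : Control T => propagator hT H₀ H₁ u :=
  differentiable_solution hT (mulCLM H₀) (mulCLM H₁) 1 ⟨T, hT, le_rfl⟩

/-- The endpoint `ρ(T)` of the solution of `ρ' = [H₀ + u H₁, ρ]`, `ρ(0) = ρ₀`. -/
def finalState (hT : 0 ≤ T) (H₀ H₁ ρ₀ : A) (u : Control T) : A :=
  solution hT (commCLM H₀) (commCLM H₁) ρ₀ u ⟨T, hT, le_rfl⟩

theorem differentiable_finalState (hT : 0 ≤ T) (H₀ H₁ ρ₀ : A) :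
    Differentiable ℝ fun u : Control T => finalState hT H₀ H₁ ρ₀ u :=
  differentiable_solution hT (commCLM H₀) (commCLM H₁) ρ₀ ⟨T, hT, le_rfl⟩

theorem exists_lipschitzOnWith_fderiv_clm_finalState (hT : 0 ≤ T) (H₀ H₁ ρ₀ : A) (J : A →L[ℝ] ℝ)
    (r : ℝ) : ∃ K : ℝ≥0,
      LipschitzOnWith K (fderiv ℝ fun u : Control T => J (finalState hT H₀ H₁ ρ₀ u))
        (Metric.closedBall 0 r) := by
  obtain ⟨K, hK⟩ :=
    exists_lipschitzOnWith_fderiv_solution hT (commCLM H₀) (commCLM H₁) ρ₀ ⟨T, hT, le_rfl⟩ r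
  have heq : (fderiv ℝ fun u : Control T => J (finalState hT H₀ H₁ ρ₀ u)) = fun u =>
      ContinuousLinearMap.compL ℝ _ _ _ J
        (fderiv ℝ (fun u : Control T => finalState hT H₀ H₁ ρ₀ u) u) := by
    funext u
    exact (J.hasFDerivAt.comp u (differentiable_finalState hT H₀ H₁ ρ₀ u).hasFDerivAt).fderiv
  rw [heq]
  exact ⟨_, (ContinuousLinearMap.lipschitz _).comp_lipschitzOnWith hK⟩

variable [StarRing A] [NormedStarGroup A] [StarModule ℝ A]

theorem star_drift {B : Type*} [AddCommGroup B] [Module ℝ B] [StarAddMonoid B] [StarModule ℝ B]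
    {H₀ H₁ : B} (h₀ : star H₀ = -H₀)
    (h₁ : star H₁ = -H₁) (c : ℝ) : star (H₀ + c • H₁) = -(H₀ + c • H₁) := by
  rw [star_add, star_smul, h₀, h₁, star_trivial, smul_neg, neg_add]

/-- For a continuous control the propagator is a classical solution, and unitary. -/
theorem exists_unitary_curve (hT : 0 ≤ T) {H₀ H₁ : A} (h₀ : star H₀ = -H₀) (h₁ : star H₁ = -H₁)
    {u : Control T} {w : ℝ → ℝ} (hw : Continuous w) (hu : u =ᵐ[volume.restrict (Icc 0 T)] w) :
    ∃ y : ℝ → A, Continuous y ∧ y 0 = 1 ∧ y T = propagator hT H₀ H₁ u ∧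
      (∀ t ∈ Icc 0 T, HasDerivAt y ((H₀ + w t • H₁) * y t) t) ∧
      ∀ t ∈ Icc 0 T, star (y t) * y t = 1 := by
  obtain ⟨y, hyc, hy0, hyT, hy⟩ :=
    exists_hasDerivAt_solution hT (mulCLM H₀) (mulCLM H₁) 1 hw hu
  have hy' : ∀ t ∈ Icc 0 T, HasDerivAt y ((H₀ + w t • H₁) * y t) t := by
    intro t ht
    refine (hy t ht).congr_deriv ?_
    exact mulCLM_add_smul ..
  refine ⟨y, hyc, hy0, hyT ⟨T, hT, le_rfl⟩, hy', fun t ht => ?_⟩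
  -- With a skew generator a, the derivative is y*(-a)y + y* a y = 0.
  have hz : ∀ t ∈ Icc 0 T, HasDerivAt (fun t => star (y t) * y t) 0 t := by
    intro t ht
    refine ((hy' t ht).star.mul (hy' t ht)).congr_deriv ?_
    rw [star_mul, star_drift h₀ h₁]
    generalize H₀ + w t • H₁ = a
    noncomm_ring
  rw [eq_of_hasDerivAt_zero hz ht, hy0, star_one, one_mul]

theorem star_propagator_mul (hT : 0 ≤ T) {H₀ H₁ : A} (h₀ : star H₀ = -H₀) (h₁ : star H₁ = -H₁)
    (u : Control T) : star (propagator hT H₀ H₁ u) * propagator hT H₀ H₁ u = 1 := by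
  have hc := (differentiable_propagator hT H₀ H₁).continuous
  refine control_induction (p := fun u =>
    star (propagator hT H₀ H₁ u) * propagator hT H₀ H₁ u = 1)
    (isClosed_eq (hc.star.mul hc) continuous_const) (fun u w hw hu => ?_) u
  obtain ⟨y, -, -, hyT, -, hy⟩ := exists_unitary_curve hT h₀ h₁ hw hu
  rw [← hyT]
  exact hy T ⟨hT, le_rfl⟩

/-- `ρ(T) = U(T) ρ₀ U(T)†`. -/
theorem finalState_eq_conj [IsDedekindFiniteMonoid A] (hT : 0 ≤ T) {H₀ H₁ : A} (h₀ : star H₀ = -H₀) (h₁ : star H₁ = -H₁)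
    (ρ₀ : A) (u : Control T) :
    finalState hT H₀ H₁ ρ₀ u = propagator hT H₀ H₁ u * ρ₀ * star (propagator hT H₀ H₁ u) := by
  have hc := (differentiable_propagator hT H₀ H₁).continuous
  refine control_induction (p := fun u => finalState hT H₀ H₁ ρ₀ u
      = propagator hT H₀ H₁ u * ρ₀ * star (propagator hT H₀ H₁ u))
    (isClosed_eq (differentiable_finalState hT H₀ H₁ ρ₀).continuous
      ((hc.mul continuous_const).mul hc.star)) (fun u w hw hu => ?_) u
  obtain ⟨y, -, hy0, hyT, hyd, hy⟩ := exists_unitary_curve hT h₀ h₁ hw hu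
  obtain ⟨x, -, hx0, hxT, hxd⟩ :=
    exists_hasDerivAt_solution hT (commCLM H₀) (commCLM H₁) ρ₀ hw hu
  -- Interaction picture: pulled back by the propagator, the state no longer moves and stays equal
  -- to ρ₀.
  have hz : ∀ t ∈ Icc 0 T, HasDerivAt (fun t => star (y t) * x t * y t) 0 t := by
    intro t ht
    have hx' : HasDerivAt x ((H₀ + w t • H₁) * x t - x t * (H₀ + w t • H₁)) t := by
      refine (hxd t ht).congr_deriv ?_
      exact commCLM_add_smul ..
    refine (((hyd t ht).star.mul hx').mul (hyd t ht)).congr_deriv ?_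
    rw [Pi.mul_apply]
    rw [star_mul, star_drift h₀ h₁]
    generalize H₀ + w t • H₁ = a
    noncomm_ring
  have hTm : T ∈ Icc 0 T := ⟨hT, le_rfl⟩
  have hconst := eq_of_hasDerivAt_zero hz hTm
  -- The curve argument gives only a left inverse; Dedekind finiteness makes it two-sided.
  have huni := mul_eq_one_comm.1 (hy T hTm)
  simp only [hy0, star_one, one_mul, mul_one, hx0] at hconst
  rw [finalState, ← hxT ⟨T, hTm⟩, ← hyT, ← hconst]
  calc x T = (y T * star (y T)) * x T * (y T * star (y T)) := by rw [huni, one_mul, mul_one]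
    _ = _ := by noncomm_ring

/-- The propagator is globally Lipschitz in the control, uniformly in the drift. -/
theorem exists_norm_propagator_sub_le [IsDedekindFiniteMonoid A] {c : ℝ} (hc0 : 0 ≤ c)
    (hc : ∀ U : A, star U * U = 1 → ‖U‖ ≤ c) (hT : 0 ≤ T) {H₁ : A} (h₁ : star H₁ = -H₁) :
    ∃ L : ℝ, 0 ≤ L ∧ ∀ H₀ : A, star H₀ = -H₀ → ∀ u v : Control T,
      ‖propagator hT H₀ H₁ v - propagator hT H₀ H₁ u‖ ≤ L * ‖v - u‖ := by
  -- The inner product c‖H₁‖c bounds the integrand y* H₁ z, the exponential comes from the weighted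
  -- Cauchy–Schwarz bound with l = 1/2, and the outer c from multiplying back by y T. The drift does
  -- not enter.
  refine ⟨c * (c * ‖H₁‖ * c * Real.exp (1 / 2 * T)), by positivity, fun H₀ h₀ u v => ?_⟩
  have hcont := (differentiable_propagator hT H₀ H₁).continuous
  refine control_induction (p := fun u =>
    ‖propagator hT H₀ H₁ v - propagator hT H₀ H₁ u‖
      ≤ c * (c * ‖H₁‖ * c * Real.exp (1 / 2 * T)) * ‖v - u‖)
    (isClosed_le (by fun_prop) (by fun_prop)) (fun u wu hwu hu => ?_) u
  refine control_induction (p := fun v =>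
    ‖propagator hT H₀ H₁ v - propagator hT H₀ H₁ u‖
      ≤ c * (c * ‖H₁‖ * c * Real.exp (1 / 2 * T)) * ‖v - u‖)
    (isClosed_le (by fun_prop) (by fun_prop)) (fun v wv hwv hv => ?_) v
  obtain ⟨y, hyc, hy0, hyT, hyd, hy⟩ := exists_unitary_curve hT h₀ h₁ hwu hu
  obtain ⟨z, hzc, hz0, hzT, hzd, hz⟩ := exists_unitary_curve hT h₀ h₁ hwv hv
  have hTm : T ∈ Icc 0 T := ⟨hT, le_rfl⟩
  -- Both curves share the skew drift H₀, which cancels in the derivative of y* z.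
  have hd : ∀ t ∈ Icc 0 T, HasDerivAt (fun t => star (y t) * z t)
      ((wv t - wu t) • (star (y t) * H₁ * z t)) t := by
    intro t ht
    refine ((hyd t ht).star.mul (hzd t ht)).congr_deriv ?_
    rw [star_mul, star_drift h₀ h₁]
    simp only [mul_neg, neg_mul, mul_add, add_mul, mul_smul_comm, smul_mul_assoc, sub_smul,
      mul_assoc]
    abel
  have hint : ∫ t in (0 : ℝ)..T, (wv t - wu t) • (star (y t) * H₁ * z t)
      = star (y T) * z T - 1 := by
    rw [intervalIntegral.integral_eq_sub_of_hasDerivAt (f := fun t => star (y t) * z t)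
      (fun t ht => hd t (by rwa [uIcc_of_le hT] at ht)), hy0, hz0, star_one, one_mul]
    exact (show Continuous fun t => (wv t - wu t) • (star (y t) * H₁ * z t) by
      fun_prop).intervalIntegrable _ _
  have hint' : ∫ t in (0 : ℝ)..T, (v - u) t • (star (y t) * H₁ * z t)
      = star (y T) * z T - 1 := by
    rw [← hint, intervalIntegral.integral_of_le hT, intervalIntegral.integral_of_le hT]
    refine integral_congr_ae ?_
    filter_upwards [ae_restrict_Ioc_of_ae_Icc hTm hu, ae_restrict_Ioc_of_ae_Icc hTm hv,
      ae_restrict_Ioc_of_ae_Icc hTm (Lp.coeFn_sub v u)] with s h1 h2 h3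
    rw [h3, Pi.sub_apply, h1, h2]
  have hbound := norm_integral_control_smul_le (v - u) (l := 1 / 2) (m := c * ‖H₁‖ * c)
    (f := fun t => star (y t) * H₁ * z t) (by norm_num) (by positivity) (fun s hs => by
      have h1 : ‖star (y s) * H₁ * z s‖ ≤ c * ‖H₁‖ * c := by
        refine norm_mul₃_le.trans ?_
        have e1 : ‖star (y s)‖ ≤ c := by
          rw [norm_star]
          exact hc _ (hy s hs)
        have e2 := hc _ (hz s hs)
        gcongr
      refine h1.trans (le_mul_of_one_le_right (by positivity) (Real.one_le_exp ?_))
      have := hs.1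
      linarith) hTm
  have h2 : √(2 * (1 / 2 : ℝ)) = 1 := by norm_num
  rw [hint', h2, div_one] at hbound
  rw [← hyT, ← hzT]
  have huni := mul_eq_one_comm.1 (hy T hTm)
  have e : z T - y T = y T * (star (y T) * z T - 1) := by
    rw [mul_sub, ← mul_assoc, huni, one_mul, mul_one]
  rw [e]
  calc _ ≤ ‖y T‖ * ‖star (y T) * z T - 1‖ := norm_mul_le _ _
    _ ≤ c * (‖v - u‖ * (c * ‖H₁‖ * c * Real.exp (1 / 2 * T))) := by
      gcongr
      exact hc _ (hy T hTm)
    _ = _ := by ring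

/-- `ρ(T)` is globally Lipschitz in the control, uniformly in the drift. -/
theorem exists_lipschitzWith_finalState [IsDedekindFiniteMonoid A] {c : ℝ} (hc0 : 0 ≤ c)
    (hc : ∀ U : A, star U * U = 1 → ‖U‖ ≤ c) (hT : 0 ≤ T) {H₁ : A} (h₁ : star H₁ = -H₁) (ρ₀ : A) :
    ∃ L : ℝ≥0, ∀ H₀ : A, star H₀ = -H₀ →
      LipschitzWith L fun u : Control T => finalState hT H₀ H₁ ρ₀ u := by
  obtain ⟨L, hL0, hL⟩ := exists_norm_propagator_sub_le hc0 hc hT h₁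
  refine ⟨⟨2 * c * ‖ρ₀‖ * L, by positivity⟩, fun H₀ h₀ =>
    LipschitzWith.of_dist_le_mul fun v u => ?_⟩
  rw [dist_eq_norm, dist_eq_norm, finalState_eq_conj hT h₀ h₁, finalState_eq_conj hT h₀ h₁]
  have hLuv := hL H₀ h₀ u v
  have hU := hc _ (star_propagator_mul hT h₀ h₁ u)
  have hV := hc _ (star_propagator_mul hT h₀ h₁ v)
  set U := propagator hT H₀ H₁ u
  set V := propagator hT H₀ H₁ v
  have e : V * ρ₀ * star V - U * ρ₀ * star U
      = (V - U) * ρ₀ * star V + U * ρ₀ * star (V - U) := by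
    rw [star_sub]
    noncomm_ring
  rw [e]
  calc _ ≤ ‖V - U‖ * ‖ρ₀‖ * ‖star V‖ + ‖U‖ * ‖ρ₀‖ * ‖star (V - U)‖ :=
        norm_add_le_of_le norm_mul₃_le norm_mul₃_le
    _ ≤ (L * ‖v - u‖) * ‖ρ₀‖ * c + c * ‖ρ₀‖ * (L * ‖v - u‖) := by
      rw [norm_star, norm_star]
      gcongr
    _ = 2 * c * ‖ρ₀‖ * L * ‖v - u‖ := by ring

/-- The differential of the end-point map takes values in the commutators with skew elements. -/
theorem exists_fderiv_finalState_eq [IsDedekindFiniteMonoid A] (hT : 0 ≤ T) {H₀ H₁ : A}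
    (h₀ : star H₀ = -H₀) (h₁ : star H₁ = -H₁) (ρ₀ : A) (u v : Control T) :
    ∃ Ω : A, star Ω = -Ω ∧ fderiv ℝ (fun w : Control T => finalState hT H₀ H₁ ρ₀ w) u v
      = finalState hT H₀ H₁ ρ₀ u * Ω - Ω * finalState hT H₀ H₁ ρ₀ u := by
  have hline : HasDerivAt (fun s : ℝ => u + s • v) v 0 := by
    simpa using ((hasDerivAt_id (0 : ℝ)).smul_const v).const_add u
  have hu0 : u + (0 : ℝ) • v = u := by simp
  have curve : ∀ {f : Control T → A}, Differentiable ℝ f →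
      HasDerivAt (fun s : ℝ => f (u + s • v)) (fderiv ℝ f u v) 0 := by
    intro f hf
    have h : HasFDerivAt f (fderiv ℝ f u) (u + (0 : ℝ) • v) := by
      rw [hu0]
      exact (hf u).hasFDerivAt
    exact h.comp_hasDerivAt 0 hline
  have hU := curve (differentiable_propagator hT H₀ H₁)
  have hρ := curve (differentiable_finalState hT H₀ H₁ ρ₀)
  set D := fderiv ℝ (fun w : Control T => propagator hT H₀ H₁ w) u v
  set U := propagator hT H₀ H₁ u with hUdef
  have c1 : star U * U = 1 := star_propagator_mul hT h₀ h₁ u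
  have c2 : U * star U = 1 := mul_eq_one_comm.1 c1
  -- Differentiating U U* = 1 along the line u + s v shows that D U* is skew.
  have k1 : D * star U + U * star D = 0 := by
    have h := hU.mul hU.star
    have hconst : ((fun s : ℝ => propagator hT H₀ H₁ (u + s • v)) *
        fun s : ℝ => star (propagator hT H₀ H₁ (u + s • v))) = fun _ => 1 := by
      funext s
      exact mul_eq_one_comm.1 (star_propagator_mul hT h₀ h₁ _)
    rw [hconst] at h
    have := h.unique (hasDerivAt_const (0 : ℝ) (1 : A))
    rwa [hu0] at this
  have k2 : fderiv ℝ (fun w : Control T => finalState hT H₀ H₁ ρ₀ w) u v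
      = D * ρ₀ * star U + U * ρ₀ * star D := by
    have h := (hU.mul_const ρ₀).mul hU.star
    have hfun : ((fun s : ℝ => propagator hT H₀ H₁ (u + s • v) * ρ₀) *
        fun s : ℝ => star (propagator hT H₀ H₁ (u + s • v)))
        = fun s : ℝ => finalState hT H₀ H₁ ρ₀ (u + s • v) := by
      funext s
      exact (finalState_eq_conj hT h₀ h₁ ρ₀ _).symm
    rw [hfun] at h
    have := hρ.unique h
    rwa [hu0] at this
  have k3 : U * star D = -(D * star U) := (neg_eq_of_add_eq_zero_right k1).symm
  -- The variation of ρ is [D U*, ρ]; the sign turns it into the convention [ρ, Ω].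
  refine ⟨-(D * star U), ?_, ?_⟩
  · rw [star_neg, star_mul, star_star, k3]
  · rw [k2, finalState_eq_conj hT h₀ h₁, ← hUdef]
    have e1 : U * ρ₀ * star D = U * ρ₀ * star U * (U * star D) := by
      calc U * ρ₀ * star D = U * ρ₀ * (star U * U) * star D := by rw [c1, mul_one]
        _ = _ := by noncomm_ring
    have e2 : D * ρ₀ * star U = D * star U * (U * ρ₀ * star U) := by
      calc D * ρ₀ * star U = D * (star U * U) * ρ₀ * star U := by rw [c1, mul_one]
        _ = _ := by noncomm_ring
    rw [e1, e2, k3]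
    noncomm_ring

end Propagator

/-! ### The end-point map on matrices and the orbit -/

section EndPoint

variable {n : ℕ} {T : ℝ}

theorem isTrajectory_iff (hT : 0 ≤ T) (H₀ H₁ ρ₀ : Mat n) (u : Control T) (ρ : ℝ → Mat n) :
    IsTrajectory H₀ H₁ ρ₀ u ρ ↔
      ∀ t : Icc (0 : ℝ) T, ρ t = solution hT (commCLM H₀) (commCLM H₁) ρ₀ u t := by
  have h : ∀ s, (H₀ + u s • H₁) * ρ s - ρ s * (H₀ + u s • H₁)
      = commCLM H₀ (ρ s) + u s • commCLM H₁ (ρ s) := fun s => (commCLM_add_smul ..).symm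
  refine Iff.trans ?_ (integral_equation_iff hT (commCLM H₀) (commCLM H₁) ρ₀ u ρ)
  unfold IsTrajectory
  simp only [h]
  exact Iff.rfl

theorem exists_unique_trajectory (hT : 0 ≤ T) (H₀ H₁ ρ₀ : Mat n) (u : Control T) :
    ∃ ρ : ℝ → Mat n, IsTrajectory H₀ H₁ ρ₀ u ρ ∧
      ∀ ρ' : ℝ → Mat n, IsTrajectory H₀ H₁ ρ₀ u ρ' → EqOn ρ' ρ (Icc 0 T) := by
  refine ⟨fun t => solution hT (commCLM H₀) (commCLM H₁) ρ₀ u (projIcc 0 T hT t),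
    (isTrajectory_iff hT ..).2 fun t => ?_, fun ρ' hρ' t ht => ?_⟩
  · simp only [projIcc_val]
  · have h := (isTrajectory_iff hT ..).1 hρ' ⟨t, ht⟩
    simp only [projIcc_of_mem hT ht]
    exact h

theorem endPoint_eq_finalState (hT : 0 ≤ T) (H₀ H₁ ρ₀ : Mat n) (u : Control T) :
    endPoint H₀ H₁ ρ₀ u = finalState hT H₀ H₁ ρ₀ u := by
  obtain ⟨ρ, hρ, -⟩ := exists_unique_trajectory hT H₀ H₁ ρ₀ u
  have h : ∃ ρ, IsTrajectory H₀ H₁ ρ₀ u ρ := ⟨ρ, hρ⟩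
  rw [endPoint, dif_pos h]
  exact (isTrajectory_iff hT _ _ _ _ _).1 h.choose_spec ⟨T, hT, le_rfl⟩

theorem endPoint_fun_eq (hT : 0 ≤ T) (H₀ H₁ ρ₀ : Mat n) :
    (fun u : Control T => endPoint H₀ H₁ ρ₀ u) = fun u => finalState hT H₀ H₁ ρ₀ u :=
  funext (endPoint_eq_finalState hT H₀ H₁ ρ₀)

theorem differentiable_endPoint (hT : 0 ≤ T) (H₀ H₁ ρ₀ : Mat n) :
    Differentiable ℝ fun u : Control T => endPoint H₀ H₁ ρ₀ u := by
  rw [endPoint_fun_eq hT]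
  exact differentiable_finalState hT H₀ H₁ ρ₀

/-- The Frobenius norm is bounded on unitary matrices. -/
theorem exists_norm_unitary_le (n : ℕ) :
    ∃ c : ℝ, 0 ≤ c ∧ ∀ U : Mat n, star U * U = 1 → ‖U‖ ≤ c := by
  -- Entries of a unitary matrix have modulus at most 1, so its Frobenius norm is at most √(n²).
  refine ⟨(∑ _i : Fin n, ∑ _j : Fin n, (1 : ℝ)) ^ (1 / 2 : ℝ), by positivity, fun U hU => ?_⟩
  rw [Matrix.frobenius_norm_def]
  refine Real.rpow_le_rpow (by positivity) ?_ (by norm_num)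
  refine Finset.sum_le_sum fun i _ => Finset.sum_le_sum fun j _ => ?_
  refine Real.rpow_le_one (norm_nonneg _) ?_ (by norm_num)
  exact entry_norm_bound_of_unitary (Matrix.mem_unitaryGroup_iff'.2 hU) i j

/-- Conjugates of `ρ₀` by unitary matrices lie in its `SU(n)`-orbit. -/
theorem conj_mem_unitaryOrbit (ρ₀ : Mat n) {U : Mat n} (hU : star U * U = 1) :
    U * ρ₀ * star U ∈ unitaryOrbit ρ₀ := by
  have hU' : U ∈ Matrix.unitaryGroup (Fin n) ℂ := Matrix.mem_unitaryGroup_iff'.2 hU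
  rcases Nat.eq_zero_or_pos n with rfl | hn
  · exact ⟨U, Matrix.mem_specialUnitaryGroup_iff.2 ⟨hU', Matrix.det_isEmpty⟩, rfl⟩
  have hdet : star U.det * U.det = 1 := (Matrix.det_of_mem_unitary hU').1
  have hd0 : U.det ≠ 0 := right_ne_zero_of_mul_eq_one hdet
  -- An n-th root of 1/det U has modulus 1, so c U lies in SU(n) and conjugates exactly as U does.
  -- The root needs n > 0, hence the separate empty case.
  obtain ⟨c, hc⟩ := IsAlgClosed.exists_pow_nat_eq (U.det)⁻¹ hn
  have hnorm : ‖U.det‖ = 1 := by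
    have := congrArg norm hdet
    rw [norm_mul, norm_star, norm_one] at this
    nlinarith [norm_nonneg U.det]
  have hcn : ‖c‖ = 1 := by
    have := congrArg norm hc
    rw [norm_pow, norm_inv, hnorm, inv_one] at this
    exact (pow_eq_one_iff_of_nonneg (norm_nonneg c) hn.ne').1 this
  have hcc : c * star c = 1 := by
    rw [Complex.star_def, Complex.mul_conj, Complex.normSq_eq_norm_sq, hcn]
    simp
  refine ⟨c • U, Matrix.mem_specialUnitaryGroup_iff.2 ⟨?_, ?_⟩, ?_⟩
  · rw [Matrix.mem_unitaryGroup_iff', star_smul, smul_mul_smul_comm, hU, mul_comm, hcc, one_smul]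
  · rw [Matrix.det_smul, Fintype.card_fin, hc, inv_mul_cancel₀ hd0]
  · rw [← Matrix.star_eq_conjTranspose, star_smul, smul_mul_assoc, smul_mul_smul_comm, hcc,
      one_smul]

theorem endPoint_mem_unitaryOrbit (hT : 0 ≤ T) {H₀ H₁ : Mat n} (h₀ : H₀ ∈ su n) (h₁ : H₁ ∈ su n)
    (ρ₀ : Mat n) (u : Control T) : endPoint H₀ H₁ ρ₀ u ∈ unitaryOrbit ρ₀ := by
  have h := finalState_eq_conj hT (A := Mat n) h₀.1 h₁.1 ρ₀ u
  rw [endPoint_eq_finalState hT, h]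
  exact conj_mem_unitaryOrbit ρ₀ (star_propagator_mul hT (A := Mat n) h₀.1 h₁.1 u)

/-- Commutators with skew-Hermitian matrices are tangent to the orbit. -/
theorem commutator_mem_tangentSpace (ρ : Mat n) {Ω : Mat n} (hΩ : Ωᴴ = -Ω) :
    ρ * Ω - Ω * ρ ∈ tangentSpace ρ := by
  -- Removing the scalar part (imaginary, since Ω is skew) makes Ω traceless without changing the
  -- commutator.
  set c : ℂ := Ω.trace / n with hc
  have hcs : star c = -c := by
    have h : star Ω.trace = -Ω.trace := by
      rw [← Matrix.trace_conjTranspose, hΩ, Matrix.trace_neg]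
    rw [hc, star_div₀, h, star_natCast, neg_div]
  refine ⟨Ω - c • (1 : Mat n), ⟨?_, ?_⟩, ?_⟩
  · rw [Matrix.conjTranspose_sub, Matrix.conjTranspose_smul, hΩ, hcs, Matrix.conjTranspose_one,
      neg_smul]
    abel
  · rw [Matrix.trace_sub, Matrix.trace_smul, Matrix.trace_one, Fintype.card_fin, hc, smul_eq_mul]
    rcases Nat.eq_zero_or_pos n with rfl | hn
    · simp [Matrix.trace]
    · rw [div_mul_cancel₀ _ (by exact_mod_cast hn.ne'), sub_self]
  · change ρ * (Ω - c • (1 : Mat n)) - (Ω - c • (1 : Mat n)) * ρ = ρ * Ω - Ω * ρ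
    rw [mul_sub, sub_mul, mul_smul_comm, smul_mul_assoc, mul_one, one_mul]
    abel

theorem dEnd_mem_tangentSpace (hT : 0 ≤ T) {H₀ H₁ : Mat n} (h₀ : H₀ ∈ su n) (h₁ : H₁ ∈ su n)
    (ρ₀ : Mat n) (u v : Control T) :
    dEnd H₀ H₁ ρ₀ u v ∈ tangentSpace (endPoint H₀ H₁ ρ₀ u) := by
  obtain ⟨Ω, hΩ, h⟩ := exists_fderiv_finalState_eq hT (A := Mat n) h₀.1 h₁.1 ρ₀ u v
  have hd : dEnd H₀ H₁ ρ₀ u v = finalState hT H₀ H₁ ρ₀ u * Ω - Ω * finalState hT H₀ H₁ ρ₀ u := by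
    rw [dEnd, endPoint_fun_eq hT]
    exact h
  rw [hd, endPoint_eq_finalState hT]
  exact commutator_mem_tangentSpace _ hΩ

end EndPoint

/-! ### The Riemannian metric and the gradient of the cost -/

section Metric

variable {n : ℕ}

theorem lift_spec {ρ ξ : Mat n} (h : ξ ∈ tangentSpace ρ) :
    lift ρ ξ ∈ horizontal ρ ∧ adMap ρ (lift ρ ξ) = ξ := by
  rw [lift, dif_pos h]
  exact (existsUnique_lift ρ ξ h).choose_spec.1

theorem lift_eq {ρ ξ Ω : Mat n} (h : ξ ∈ tangentSpace ρ) (hΩ : Ω ∈ horizontal ρ)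
    (hξ : adMap ρ Ω = ξ) : lift ρ ξ = Ω :=
  (existsUnique_lift ρ ξ h).unique (lift_spec h) ⟨hΩ, hξ⟩

/-- `lift` is defined by choice; its linearity comes from uniqueness of the horizontal
representative. -/
theorem lift_add {ρ ξ η : Mat n} (hξ : ξ ∈ tangentSpace ρ) (hη : η ∈ tangentSpace ρ) :
    lift ρ (ξ + η) = lift ρ ξ + lift ρ η := by
  obtain ⟨⟨h1, h2⟩, h3⟩ := lift_spec hξ
  obtain ⟨⟨k1, k2⟩, k3⟩ := lift_spec hη
  refine lift_eq ((tangentSpace ρ).add_mem hξ hη) ⟨(su n).add_mem h1 k1, fun Ω' h' => ?_⟩ ?_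
  · rw [Matrix.conjTranspose_add, Matrix.add_mul, Matrix.trace_add, h2 _ h', k2 _ h', add_zero]
  · rw [map_add, h3, k3]

theorem lift_smul {ρ ξ : Mat n} (c : ℝ) (hξ : ξ ∈ tangentSpace ρ) :
    lift ρ (c • ξ) = c • lift ρ ξ := by
  obtain ⟨⟨h1, h2⟩, h3⟩ := lift_spec hξ
  refine lift_eq ((tangentSpace ρ).smul_mem c hξ) ⟨(su n).smul_mem c h1, fun Ω' h' => ?_⟩ ?_
  · rw [Matrix.conjTranspose_smul, Matrix.smul_mul, Matrix.trace_smul, h2 _ h', smul_zero]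
  · rw [map_smul, h3]

/-- The Riemannian metric as a bilinear form on the tangent space. -/
def metricForm (ρ : Mat n) : LinearMap.BilinForm ℝ (tangentSpace ρ) :=
  LinearMap.mk₂ ℝ (fun ξ η => metric ρ ξ η)
    (by
      intro ξ ξ' η
      simp [metric, lift_add ξ.2 ξ'.2, Matrix.add_mul])
    (by
      intro c ξ η
      simp [metric, lift_smul c ξ.2, Matrix.conjTranspose_smul])
    (by
      intro ξ η η'
      simp [metric, lift_add η.2 η'.2, Matrix.mul_add])
    (by
      intro c ξ η
      simp [metric, lift_smul c η.2])

theorem metricForm_apply (ρ : Mat n) (ξ η : tangentSpace ρ) :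
    metricForm ρ ξ η = metric ρ ξ η := rfl

theorem eq_zero_of_metric_self {ρ : Mat n} (ξ : tangentSpace ρ) (h : metric ρ ξ ξ = 0) :
    ξ = 0 := by
  have h0 : lift ρ ξ = 0 := by
    open scoped ComplexOrder in
    rw [← Matrix.trace_conjTranspose_mul_self_eq_zero_iff]
    have hre := (Matrix.posSemidef_conjTranspose_mul_self (lift ρ (ξ : Mat n))).trace_nonneg
    exact Complex.ext h (Complex.nonneg_iff.1 hre).2.symm
  have := (lift_spec ξ.2).2
  rw [h0, map_zero] at this
  exact Subtype.ext this.symm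

/-- Definiteness gives injectivity into the dual, and equality of finite dimensions gives the rest.
This is the Riesz representation that produces ∇J. -/
theorem metricForm_bijective (ρ : Mat n) : Function.Bijective (metricForm ρ) := by
  have hinj : Function.Injective (metricForm ρ) := by
    rw [injective_iff_map_eq_zero]
    intro ξ hξ
    exact eq_zero_of_metric_self ξ (by rw [← metricForm_apply, hξ, LinearMap.zero_apply])
  exact ⟨hinj, (LinearMap.injective_iff_surjective_of_finrank_eq_finrank
    (Subspace.dual_finrank_eq).symm).1 hinj⟩

/-- The cost as a continuous linear functional. -/
def costCLM (θ : Mat n) : Mat n →L[ℝ] ℝ :=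
  LinearMap.toContinuousLinearMap
    { toFun := costJ θ
      map_add' := fun x y => by simp [costJ, Matrix.add_mul]
      map_smul' := fun c x => by simp [costJ] }

theorem hasFDerivAt_costJ (θ ρ : Mat n) : HasFDerivAt (costJ θ) (costCLM θ) ρ :=
  (costCLM θ).hasFDerivAt

theorem fderiv_costJ (θ ρ : Mat n) : fderiv ℝ (costJ θ) ρ = costCLM θ :=
  (hasFDerivAt_costJ θ ρ).fderiv

theorem existsUnique_gradJ (θ ρ : Mat n) : ∃! ζ, IsGradJ θ ρ ζ := by
  have hiff : ∀ ζ, IsGradJ θ ρ ζ ↔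
      metricForm ρ ζ = (costCLM θ : Mat n →ₗ[ℝ] ℝ).comp (tangentSpace ρ).subtype := by
    intro ζ
    rw [IsGradJ, LinearMap.ext_iff]
    refine forall_congr' fun η => ?_
    rw [fderiv_costJ, metricForm_apply]
    exact eq_comm
  simp only [hiff]
  exact (metricForm_bijective ρ).existsUnique _

theorem isGradJ_gradJ (θ ρ : Mat n) : IsGradJ θ ρ (gradJ θ ρ) := by
  have h := (existsUnique_gradJ θ ρ).exists
  rw [gradJ, dif_pos h]
  exact h.choose_spec

end Metric

/-! ### The adjoint differential and estimates for the gradient field -/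

section Adjoint

variable {n : ℕ} {T : ℝ}

/-- The Riesz theorem in L² represents each bounded functional v ↦ ⟨z, dEnd v⟩; the representative
is linear in z. -/
theorem existsUnique_adjoint (hT : 0 ≤ T) {H₀ H₁ : Mat n} (h₀ : H₀ ∈ su n) (h₁ : H₁ ∈ su n)
    (ρ₀ : Mat n) (u : Control T) : ∃! A, IsAdjoint H₀ H₁ ρ₀ u A := by
  set d : Control T →L[ℝ] tangentSpace (endPoint H₀ H₁ ρ₀ u) :=
    (dEnd H₀ H₁ ρ₀ u).codRestrict _ (dEnd_mem_tangentSpace hT h₀ h₁ ρ₀ u) with hd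
  set B : tangentSpace (endPoint H₀ H₁ ρ₀ u) → StrongDual ℝ (Control T) := fun z =>
    (LinearMap.toContinuousLinearMap (metricForm _ z)).comp d with hB
  have hBapply : ∀ z v, B z v = metric (endPoint H₀ H₁ ρ₀ u) z (dEnd H₀ H₁ ρ₀ u v) :=
    fun z v => rfl
  let A : tangentSpace (endPoint H₀ H₁ ρ₀ u) →ₗ[ℝ] Control T :=
    { toFun := fun z => (InnerProductSpace.toDual ℝ (Control T)).symm (B z)
      map_add' := fun z z' => by
        rw [← map_add]
        congr 1
        ext v
        simp [hB]
      map_smul' := fun c z => by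
        have : B (c • z) = c • B z := by
          ext v
          simp [hB]
        rw [this, map_smulₛₗ]
        simp }
  refine ⟨A, fun z v => ?_, fun A' hA' => ?_⟩
  · change _ = inner ℝ ((InnerProductSpace.toDual ℝ (Control T)).symm (B z)) v
    rw [InnerProductSpace.toDual_symm_apply, hBapply]
  · ext1 z
    refine ext_inner_right ℝ fun v => ?_
    rw [← hA' z v, ← hBapply]
    exact (InnerProductSpace.toDual_symm_apply).symm

theorem isAdjoint_dEndAdj (hT : 0 ≤ T) {H₀ H₁ : Mat n} (h₀ : H₀ ∈ su n) (h₁ : H₁ ∈ su n)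
    (ρ₀ : Mat n) (u : Control T) : IsAdjoint H₀ H₁ ρ₀ u (dEndAdj H₀ H₁ ρ₀ u) := by
  have h := (existsUnique_adjoint hT h₀ h₁ ρ₀ u).exists
  rw [dEndAdj, dif_pos h]
  exact h.choose_spec

/-- The right-hand side of the gradient flow is the gradient of the cost functional. -/
theorem hasGradientAt_flowField (hT : 0 ≤ T) {H₀ H₁ : Mat n} (h₀ : H₀ ∈ su n) (h₁ : H₁ ∈ su n)
    (ρ₀ θ : Mat n) (u : Control T) :
    HasGradientAt (fun w : Control T => costJ θ (endPoint H₀ H₁ ρ₀ w))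
      (flowField H₀ H₁ ρ₀ θ u) u := by
  have hd : HasFDerivAt (fun w : Control T => endPoint H₀ H₁ ρ₀ w) (dEnd H₀ H₁ ρ₀ u) u :=
    (differentiable_endPoint hT H₀ H₁ ρ₀ u).hasFDerivAt
  have h : HasFDerivAt (fun w : Control T => costJ θ (endPoint H₀ H₁ ρ₀ w))
      ((costCLM θ).comp (dEnd H₀ H₁ ρ₀ u)) u :=
    (hasFDerivAt_costJ θ (endPoint H₀ H₁ ρ₀ u)).comp u hd
  rw [hasGradientAt_iff_hasFDerivAt]
  refine h.congr_fderiv ?_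
  ext v
  have e1 := isGradJ_gradJ θ (endPoint H₀ H₁ ρ₀ u)
    ⟨_, dEnd_mem_tangentSpace hT h₀ h₁ ρ₀ u v⟩
  have e2 := isAdjoint_dEndAdj hT h₀ h₁ ρ₀ u (gradJ θ (endPoint H₀ H₁ ρ₀ u)) v
  rw [fderiv_costJ] at e1
  rw [InnerProductSpace.toDual_apply_apply]
  exact e1.trans e2

/-- Since `toDual` is an isometry, bounds and Lipschitz estimates for the field reduce to those for
the Fréchet derivative of the cost. -/
theorem toDual_flowField (hT : 0 ≤ T) {H₀ H₁ : Mat n} (h₀ : H₀ ∈ su n) (h₁ : H₁ ∈ su n)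
    (ρ₀ θ : Mat n) (u : Control T) :
    InnerProductSpace.toDual ℝ (Control T) (flowField H₀ H₁ ρ₀ θ u)
      = fderiv ℝ (fun w : Control T => costJ θ (endPoint H₀ H₁ ρ₀ w)) u :=
  (hasGradientAt_flowField hT h₀ h₁ ρ₀ θ u).hasFDerivAt.fderiv.symm

/-- The cost is Lipschitz in the control with a constant fixed before H₀, and a derivative is
bounded by the Lipschitz constant. -/
theorem exists_norm_flowField_le (hT : 0 ≤ T) {H₁ : Mat n} (h₁ : H₁ ∈ su n) (ρ₀ θ : Mat n) :
    ∃ C : ℝ, ∀ H₀ ∈ su n, ∀ u : Control T, ‖flowField H₀ H₁ ρ₀ θ u‖ ≤ C := by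
  obtain ⟨c, hc0, hc⟩ := exists_norm_unitary_le n
  obtain ⟨L, hL⟩ := exists_lipschitzWith_finalState hc0 hc hT (A := Mat n) h₁.1 ρ₀
  obtain ⟨K, hK⟩ : ∃ K : ℝ≥0, LipschitzWith K (costJ θ) := ⟨_, (costCLM θ).lipschitz⟩
  refine ⟨K * L, fun H₀ h₀ u => ?_⟩
  have hlip : LipschitzWith (K * L) fun w : Control T => costJ θ (endPoint H₀ H₁ ρ₀ w) := by
    simp only [endPoint_eq_finalState hT]
    exact hK.comp (hL H₀ h₀.1)
  rw [← (InnerProductSpace.toDual ℝ (Control T)).norm_map, toDual_flowField hT h₀ h₁]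
  simpa using norm_fderiv_le_of_lipschitz ℝ hlip

theorem exists_lipschitzOnWith_flowField (hT : 0 ≤ T) {H₀ H₁ : Mat n} (h₀ : H₀ ∈ su n)
    (h₁ : H₁ ∈ su n) (ρ₀ θ : Mat n) (r : ℝ) :
    ∃ K : ℝ≥0, LipschitzOnWith K (fun u : Control T => flowField H₀ H₁ ρ₀ θ u)
      (Metric.closedBall 0 r) := by
  obtain ⟨K, hK⟩ := exists_lipschitzOnWith_fderiv_clm_finalState hT H₀ H₁ ρ₀ (costCLM θ) r
  have hfun : (fun w : Control T => costJ θ (endPoint H₀ H₁ ρ₀ w))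
      = fun w => costCLM θ (finalState hT H₀ H₁ ρ₀ w) := by
    funext w
    rw [endPoint_eq_finalState hT]
    rfl
  refine ⟨K, LipschitzOnWith.of_dist_le_mul fun u hu v hv => ?_⟩
  rw [← (InnerProductSpace.toDual ℝ (Control T)).dist_map, toDual_flowField hT h₀ h₁,
    toDual_flowField hT h₀ h₁, hfun]
  exact hK.dist_le_mul u hu v hv

end Adjoint

end QuantumControl

end

theorem mainTheorem6 (n : ℕ) (T : ℝ) (hT : 0 < T) (ρ₀ H₁ θ : Mat n)
    (hρ₀ : ρ₀.IsHermitian) (hH₁ : H₁ ∈ su n) (hθ : θ.IsHermitian) :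
    ∃ C : ℝ, ∀ H₀ ∈ su n,
      -- every object in the equation is well defined, and the right-hand side is
      -- the gradient of `u ↦ J(End(u))`, bounded by `C`
      (∀ u : Control T,
        (∃ ρ : ℝ → Mat n, IsTrajectory H₀ H₁ ρ₀ u ρ ∧
          ∀ ρ' : ℝ → Mat n, IsTrajectory H₀ H₁ ρ₀ u ρ' → EqOn ρ' ρ (Icc 0 T)) ∧
        endPoint H₀ H₁ ρ₀ u ∈ unitaryOrbit ρ₀ ∧
        DifferentiableAt ℝ (fun w : Control T => endPoint H₀ H₁ ρ₀ w) u ∧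
        (∀ v : Control T, dEnd H₀ H₁ ρ₀ u v ∈ tangentSpace (endPoint H₀ H₁ ρ₀ u)) ∧
        (∃! A, IsAdjoint H₀ H₁ ρ₀ u A) ∧
        (∃! ζ, IsGradJ θ (endPoint H₀ H₁ ρ₀ u) ζ) ∧
        HasGradientAt (fun w : Control T => costJ θ (endPoint H₀ H₁ ρ₀ w))
          (flowField H₀ H₁ ρ₀ θ u) u ∧
        ‖flowField H₀ H₁ ρ₀ θ u‖ ≤ C) ∧
      -- global existence and uniqueness
      ∀ u₀ : Control T, ∃ P : ℝ → Control T,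
        IsFlowSolution H₀ H₁ ρ₀ θ u₀ (Ici 0) P ∧
        ∀ I : Set ℝ, I.OrdConnected → 0 ∈ I → I ⊆ Ici 0 →
          ∀ Q : ℝ → Control T, IsFlowSolution H₀ H₁ ρ₀ θ u₀ I Q → EqOn Q P I := by
  obtain ⟨C, hC⟩ := exists_norm_flowField_le hT.le hH₁ ρ₀ θ
  refine ⟨C, fun H₀ h₀ => ⟨fun u => ⟨exists_unique_trajectory hT.le H₀ H₁ ρ₀ u,
    endPoint_mem_unitaryOrbit hT.le h₀ hH₁ ρ₀ u, differentiable_endPoint hT.le H₀ H₁ ρ₀ u,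
    dEnd_mem_tangentSpace hT.le h₀ hH₁ ρ₀ u, existsUnique_adjoint hT.le h₀ hH₁ ρ₀ u,
    existsUnique_gradJ θ _, hasGradientAt_flowField hT.le h₀ hH₁ ρ₀ θ u, hC H₀ h₀ u⟩,
    fun u₀ => ?_⟩⟩
  exact exists_global_integralCurve (hC H₀ h₀)
    (exists_lipschitzOnWith_flowField hT.le h₀ hH₁ ρ₀ θ) u₀
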